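/- **Setting.** Fix a first-order language with a structure $V$ for it (the theory, which fixes the interpretation of all symbols of the game, as linear integer or real arithmetic does); $\models$ is satisfaction in $V$. A *reactive program game structure* $\mathcal G=(\mathbb I,\mathbb X,L,\mathit{Inv},\delta)$ consists of finite disjoint sets $\mathbb I,\mathbb X$ of input and program variables, a finite set $L$ of locations, a formula $\mathit{Inv}(l)$ over $\mathbb X$ for each $l\in L$, and a finite set $\delta$ of transitions $(l,g,u,l')$ with a quantifier-free guard $g$ over $\mathbb X\cup\mathbb I$ and an update $u$ mapping each $x\in\mathbb X$ to a term over $\mathbb X\cup\mathbb I$, such that: (1) for each $l$ the guards of transitions from $l$ cover all assignments and distinct ones are disjoint; (2) source, guard and update determine the target; (3) from every $(l,\nu)$ with $\nu\models\mathit{Inv}(l)$ some input permits a transition, i.e. its guard holds and the updated assignment satisfies the invariant of the target. Throughout, assume that $\mathcal G$ is *input-enabled*: in every such $(l,\nu)$ *every* input assignment permits a transition (for instance, all invariants are $\top$). The game $[\![\mathcal G]\!]$ has the states $(l,\nu)$ with $\nu\models\mathit{Inv}(l)$. In each step $\mathit{Env}$ chooses an input assignment and then $\mathit{Sys}$ an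 update, such that a transition is permitted, which gives the next state. Strategies may depend on the finite sequence of states so far ($\mathit{Sys}$'s also on the current input). $W_p([\![\mathcal G]\!],\Omega)$ is the set of states from which Player $p$ has a strategy such that every resulting play is in $\Omega$, and $1-p$ is the opponent of $p$. For $B\subseteq L$, $\mathit{coBuchi}(B)$ is the set of plays that visit locations in $B$ only finitely often. A symbolic set $d\in\mathcal D$ maps each location to a formula over $\mathbb X$; $[\![d]\!]$ is the set of states $(l,\nu)$ with $\nu\models d(l)$; $d\equiv d'$ means $[\![d]\!]=[\![d']\!]$; $d[l\mapsto\varphi]$ changes the value at $l$ to $\varphi$; Boolean operations are applied per location; $\{l\mapsto\varphi_l\mid l\in B\}$ is $\bot$ outside $B$. With $\varphi[u]$ the substitution of $u(x)$ for each $x\in\mathbb X$, $$\mathit{CPre}_{\mathcal G,\mathit{Env}}(d)(l)=\mathit{Inv}(l)\wedge\exists\mathbb I.\bigwedge_{(l,g,u,l')\in\delta}\big(g\wedge\mathit{Inv}(l')[u]\to d(l')[u]\big),$$ $$\mathit{CPre}_{\mathcal G,\mathit{Sys}}(d)(l)=\mathit{Inv}(l)\wedge\forall\mathbb I.\bigvee_{(l,g,u,l')\in\delta}\big(g\wedge\mathit{Inv}(l')[u]\wedge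 d(l')[u]\big).$$ An *acceleration lemma* is a triple $(\mathit{base},\mathit{step},\mathit{conc})$ of formulas over $\mathbb X$, $\mathbb X\cup\mathbb X'$, $\mathbb X$ such that every infinite sequence $\alpha$ of assignments with $\alpha_0\models\mathit{conc}$ and $(\alpha_i,\alpha_{i+1})\models\mathit{step}$ for all $i$ has some $\alpha_k\models\mathit{base}$, and whenever $\nu\models\mathit{conc}\wedge\neg\mathit{base}$ and $(\nu,\nu')\models\mathit{step}$ then $\nu'\models\mathit{conc}$. The *loop game* $\mathsf{LoopGame}(\mathcal G,l,l_{End})$ adds a new location $l_{End}$ with invariant $\mathit{Inv}(l)$ and a self-loop with guard $\top$ and identity update, and redirects all transitions with target $l$ to $l_{End}$. **Procedures.** Whether to iterate, whether and at which location to accelerate, and which lemmas are found, is decided by arbitrary heuristics; co-Büchi acceleration ($\mathsf{AccB}$) is attempted only at accepting locations: $l\in B$ in $\mathcal G$, and if $A$ is the set of accepting locations of a game, then $A\cup\{l_{End}\}$ is that of its loop games. The formulas below may contain uninterpreted lemma predicate symbols $b$ (of $\mathbb X$), $st$ (of $\mathbb X,\mathbb X'$), $c$ (of $\mathbb X$)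 and uninterpreted constants; constraints $\Psi$ have no free variables. * $\mathsf{AccA}(\mathcal G,p,l,d)$: pick fresh lemma symbols $(b,st,c)$ and fresh constants $E=\{e_x\mid x\in\mathbb X\}$. Let $(\Psi_r,a)=\mathsf{IterA}(\mathsf{LoopGame}(\mathcal G,l,l_{End}),p,\top,d\cup\{l_{End}\mapsto st(E,\mathbb X)\})[E\mapsto\mathbb X]$. Return $\big(\Psi,\ c(\mathbb X)\wedge\mathit{Inv}(l)\big)$ with $\Psi=(\forall\mathbb X.\,\mathit{Inv}(l)\wedge b(\mathbb X)\to d(l))\wedge(\forall\mathbb X.\,\mathit{Inv}(l)\wedge\neg d(l)\wedge c(\mathbb X)\to\Psi_r\wedge a(l))$. * $\mathsf{IterA}(\mathcal G,p,\Psi,d)$ either returns $(\Psi,d)$; or takes $(\Psi_r,\varphi)=\mathsf{AccA}(\mathcal G,p,l,d)$ for some $l$ and returns $\mathsf{IterA}(\mathcal G,p,\Psi\wedge\Psi_r,d[l\mapsto d(l)\vee\varphi])$; or returns $\mathsf{IterA}(\mathcal G,p,\Psi,d\vee\mathit{CPre}_{\mathcal G,p}(d))$. * $\mathsf{AccB}(\mathcal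 G,p,l,f)$: pick fresh $(b,st,c)$ and $E$. Let $(\Psi_r,a)=\mathsf{IterB}(\mathsf{LoopGame}(\mathcal G,l,l_{End}),p,\top,f\cup\{l_{End}\mapsto\neg st(E,\mathbb X)\},\bot)[E\mapsto\mathbb X]$. Return $\big(\Psi,\ c(\mathbb X)\wedge\mathit{Inv}(l)\big)$ with $\Psi=(\forall\mathbb X.\,\mathit{Inv}(l)\wedge b(\mathbb X)\to\neg f(l))\wedge(\forall\mathbb X.\,\mathit{Inv}(l)\wedge f(l)\wedge c(\mathbb X)\to\Psi_r\wedge a(l))$. * $\mathsf{IterB}(\mathcal G,p,\Psi,f,w)$ either returns $(\Psi,w)$, or computes $(\Psi_1,a)=\mathsf{IterA}(\mathcal G,p,\Psi,f)$, $(\Psi_2,w')=\mathsf{IterA}(\mathcal G,1-p,\Psi,\mathit{Inv}\wedge\neg\mathit{CPre}_{\mathcal G,p}(a))$, $f'=f\wedge(\mathit{Inv}\wedge\neg w')$ and $\Psi'=\Psi\wedge\Psi_1\wedge\mathsf{Precise}(\mathcal G,p,a)\wedge\Psi_2$, where $\mathsf{Precise}(\mathcal G,p,a)=\bigwedge_{l\in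 L}\forall\mathbb X.\,\mathit{CPre}_{\mathcal G,p}(a)(l)\to a(l)$. Then it either returns $\mathsf{IterB}(\mathcal G,p,\Psi',f',w')$, or, for an accepting location $l$ and $(\Psi_3,\varphi)=\mathsf{AccB}(\mathcal G,p,l,f')$, returns $\mathsf{IterB}(\mathcal G,p,\Psi'\wedge\Psi_3,f'[l\mapsto f'(l)\wedge\neg\varphi],w'[l\mapsto w'(l)\vee\varphi])$. * $\mathsf{InstantiateLemmas}(\Psi,\varphi)$: if acceleration lemmas $\lambda$ for the lemma symbols are found such that $\Psi[\lambda]$ is valid, return $\varphi[\lambda]$; otherwise return $\bot$. * $\textsc{AttractorAcc}(\mathcal G,p,d)$: start with $a^0=\bot$, $a^1=d$. For $n=1,2,\dots$: if $a^n\equiv a^{n-1}$ return $a^n$; optionally, for some $l\in L$ and $(\Psi,\varphi)=\mathsf{AccA}(\mathcal G,p,l,a^n)$, replace $a^n(l)$ by $a^n(l)\vee\mathsf{InstantiateLemmas}(\Psi,\varphi)$; put $a^{n+1}=a^n\vee\mathit{CPre}_{\mathcal G,p}(a^n)$. * $\textsc{SolveBüchiAcc}(\mathcal G,p,f)$: start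 with $f^0=\top$, $f^1=f$, $w^0=\bot$. For $n=1,2,\dots$: if $f^n\equiv f^{n-1}$ return $w^{n-1}$; let $a^n=\textsc{AttractorAcc}(\mathcal G,p,f^n)$ and $w^n=\textsc{AttractorAcc}(\mathcal G,1-p,\neg\mathit{CPre}_{\mathcal G,p}(a^n))$; optionally, for some $l\in B$ and $(\Psi,\varphi)=\mathsf{AccB}(\mathcal G,p,l,f^n\wedge(\mathit{Inv}\wedge\neg w^n))$, replace $w^n(l)$ by $w^n(l)\vee\mathsf{InstantiateLemmas}(\Psi,\varphi)$; put $f^{n+1}=f^n\wedge(\mathit{Inv}\wedge\neg w^n)$. **Proposition (Soundness of SolveBüchiAcc).** Let $\mathcal G$ be an input-enabled reactive program game structure, $p\in\{\mathit{Sys},\mathit{Env}\}$ and $B\subseteq L$. If a run of $\textsc{SolveBüchiAcc}(\mathcal G,p,\{l\mapsto\mathit{Inv}(l)\mid l\in B\})$ terminates returning $w$, then $$[\![w]\!]=W_{1-p}([\![\mathcal G]\!],\mathit{coBuchi}(B)).$$ -/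

import Mathlib

namespace ReactiveGame

open FirstOrder FirstOrder.Language

universe u v w x y

/-! ## Two-player games of infinite duration -/

/-- The two players: environment and system. -/
inductive Player : Type
  | env
  | sys

/-- The opponent `1 - p` of player `p`. -/
def Player.opp : Player → Player
  | .env => .sys
  | .sys => .env

/-- Game structures: in a state the environment moves first, the system answers, and the two moves
determine the next state. Every state has a successor. -/
structure GameStructure (S Me Ms : Type*) where
  trans : S → Me → Ms → S → Prop
  exists_succ : ∀ s, ∃ me ms s', trans s me ms s'
  succ_unique : ∀ s me ms s₁ s₂, trans s me ms s₁ → trans s me ms s₂ → s₁ = s₂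

namespace GameStructure

variable {S Me Ms : Type*} (G : GameStructure S Me Ms)

/-- The enabled environment moves in a state. -/
def enabledEnv (s : S) : Set Me := {me | ∃ ms s', G.trans s me ms s'}

/-- The enabled system moves in a state, after an environment move. -/
def enabledSys (s : S) (me : Me) : Set Ms := {ms | ∃ s', G.trans s me ms s'}

/-- Strategies of the environment. The nonempty history `s₀ … sₙ` is given as the list
`[s₀, …, sₙ₋₁]` together with the current state `sₙ`. -/
structure EnvStrategy where
  move : List S → S → Me
  enabled : ∀ h s, move h s ∈ G.enabledEnv s

/-- Strategies of the system: the answer to an enabled environment move is an enabled move (the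
value on environment moves that are not enabled is irrelevant). -/
structure SysStrategy where
  move : List S → S → Me → Ms
  enabled : ∀ h s me, me ∈ G.enabledEnv s → move h s me ∈ G.enabledSys s me

/-- `π` is the play from `s` that results when both players follow the given strategies. -/
def IsOutcome (s : S) (σe : G.EnvStrategy) (σs : G.SysStrategy) (π : ℕ → S) : Prop :=
  π 0 = s ∧ ∀ i, G.trans (π i)
    (σe.move ((List.range i).map π) (π i))
    (σs.move ((List.range i).map π) (π i) (σe.move ((List.range i).map π) (π i)))
    (π (i + 1))

/-- `W_p(G, Ω)`: the states from which player `p` has a strategy all of whose plays, against all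
strategies of the opponent, belong to the objective `Ω`. -/
def winning (p : Player) (Ω : Set (ℕ → S)) : Set S :=
  match p with
  | .env => {s | ∃ σe : G.EnvStrategy, ∀ (σs : G.SysStrategy) (π : ℕ → S),
      G.IsOutcome s σe σs π → π ∈ Ω}
  | .sys => {s | ∃ σs : G.SysStrategy, ∀ (σe : G.EnvStrategy) (π : ℕ → S),
      G.IsOutcome s σe σs π → π ∈ Ω}

end GameStructure

/-! ## Reactive program games

The theory is given by its structure `V` for the language `L` of the game. The program variables
are indexed by `Fin m` and the input variables by `I`; assignments are functions `Fin m → V` and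
`I → V`. -/

/-- Symbolic transitions `(l, g, u, l')`. -/
structure Transition (L : FirstOrder.Language.{u, v}) (I : Type w) (m : ℕ) (Loc : Type x) where
  src : Loc
  guard : L.Formula (Fin m ⊕ I)
  update : Fin m → L.Term (Fin m ⊕ I)
  tgt : Loc

/-- Reactive program game structures. -/
structure ProgramGame (L : FirstOrder.Language.{u, v}) (V : Type y) [L.Structure V] (I : Type w) (m : ℕ)
    (Loc : Type x) where
  loc_finite : Finite Loc
  inv : Loc → L.Formula (Fin m)
  δ : Set (Transition L I m Loc)
  δ_finite : δ.Finite
  guard_qf : ∀ t ∈ δ, t.guard.IsQF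
  guard_total : ∀ (l : Loc) (a : Fin m → V) (i : I → V),
    ∃ t ∈ δ, t.src = l ∧ t.guard.Realize (Sum.elim a i)
  guard_disjoint : ∀ t₁ ∈ δ, ∀ t₂ ∈ δ, t₁.src = t₂.src → t₁.guard ≠ t₂.guard →
    ∀ (a : Fin m → V) (i : I → V),
      ¬ (t₁.guard.Realize (Sum.elim a i) ∧ t₂.guard.Realize (Sum.elim a i))
  tgt_unique : ∀ t₁ ∈ δ, ∀ t₂ ∈ δ, t₁.src = t₂.src → t₁.guard = t₂.guard →
    t₁.update = t₂.update → t₁.tgt = t₂.tgt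
  no_dead_end : ∀ (l : Loc) (a : Fin m → V), (inv l).Realize a →
    ∃ t ∈ δ, t.src = l ∧ ∃ i : I → V, t.guard.Realize (Sum.elim a i) ∧
      (inv t.tgt).Realize (fun z => (t.update z).realize (Sum.elim a i))

namespace ProgramGame

variable {L : FirstOrder.Language.{u, v}} {V : Type y} [L.Structure V] {I : Type w} {m : ℕ} {Loc : Type x}

/-- No input is blocked by the location invariants: in every state, for every input assignment
some transition can be taken. -/
def InputEnabled (G : ProgramGame L V I m Loc) : Prop :=
  ∀ (l : Loc) (a : Fin m → V), (G.inv l).Realize a → ∀ i : I → V,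
    ∃ t ∈ G.δ, t.src = l ∧ t.guard.Realize (Sum.elim a i) ∧
      (G.inv t.tgt).Realize (fun z => (t.update z).realize (Sum.elim a i))

/-- The states of the game: a location and an assignment that satisfies its invariant. -/
def State (G : ProgramGame L V I m Loc) : Type (max x y) :=
  {s : Loc × (Fin m → V) // (G.inv s.1).Realize s.2}

/-- The location of a state. -/
def State.loc {G : ProgramGame L V I m Loc} (s : G.State) : Loc := s.1.1

/-- The variable assignment of a state. -/
def State.val {G : ProgramGame L V I m Loc} (s : G.State) : Fin m → V := s.1.2

/-- The updates of the game. -/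
def Updates (G : ProgramGame L V I m Loc) : Set (Fin m → L.Term (Fin m ⊕ I)) :=
  {f | ∃ t ∈ G.δ, t.update = f}

/-- The transitions that leave location `l`. -/
abbrev Out (G : ProgramGame L V I m Loc) (l : Loc) : Type _ :=
  {t : Transition L I m Loc // t ∈ G.δ ∧ t.src = l}

instance finite_out (G : ProgramGame L V I m Loc) (l : Loc) : Finite (G.Out l) :=
  Set.finite_coe_iff.mpr (G.δ_finite.subset fun _ h => h.1)

/-- The semantics `⟦G⟧`: the environment chooses inputs, the system chooses updates. -/
def sem (G : ProgramGame L V I m Loc) : GameStructure G.State (I → V) G.Updates where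
  trans s i f s' := ∃ t ∈ G.δ, t.src = s.loc ∧ t.update = f.1 ∧ t.tgt = s'.loc ∧
    t.guard.Realize (Sum.elim s.val i) ∧
    s'.val = fun z => (f.1 z).realize (Sum.elim s.val i)
  exists_succ s := by
    obtain ⟨t, ht, hs, i, hg, hi⟩ := G.no_dead_end s.loc s.val s.2
    exact ⟨i, ⟨t.update, t, ht, rfl⟩, ⟨(t.tgt, _), hi⟩, t, ht, hs, rfl, rfl, hg, rfl⟩
  succ_unique := by
    rintro s i f s₁ s₂ ⟨t₁, h₁, hs₁, hu₁, ht₁, hg₁, hv₁⟩ ⟨t₂, h₂, hs₂, hu₂, ht₂, hg₂, hv₂⟩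
    have hs : t₁.src = t₂.src := hs₁.trans hs₂.symm
    have hg : t₁.guard = t₂.guard := by
      by_contra hne
      exact G.guard_disjoint t₁ h₁ t₂ h₂ hs hne _ _ ⟨hg₁, hg₂⟩
    have hl : s₁.loc = s₂.loc := by
      rw [← ht₁, ← ht₂]
      exact G.tgt_unique t₁ h₁ t₂ h₂ hs hg (hu₁.trans hu₂.symm)
    exact Subtype.ext (Prod.ext hl (hv₁.trans hv₂.symm))

/-- The co-Büchi objective: locations in `B` are visited only finitely often. -/
def coBuchi (G : ProgramGame L V I m Loc) (B : Set Loc) : Set (ℕ → G.State) :=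
  {π | ∃ k, ∀ n ≥ k, (π n).loc ∉ B}

open Classical in
/-- The loop game at location `l`: the new location `none` is `l_End`, transitions into `l` are
redirected to it, and it gets a self loop. -/
noncomputable def loop (G : ProgramGame L V I m Loc) (l : Loc) :
    ProgramGame L V I m (Option Loc) where
  loc_finite := by
    have := G.loc_finite
    infer_instance
  inv := fun o => o.elim (G.inv l) G.inv
  δ := (fun t : Transition L I m Loc =>
        (⟨some t.src, t.guard, t.update, if t.tgt = l then none else some t.tgt⟩ :
          Transition L I m (Option Loc))) '' G.δ ∪
      {⟨none, ⊤, fun z => Term.var (Sum.inl z), none⟩}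
  δ_finite := (G.δ_finite.image _).union (Set.finite_singleton _)
  guard_qf := by
    rintro _ (⟨t, ht, rfl⟩ | rfl)
    · exact G.guard_qf t ht
    · exact BoundedFormula.IsQF.top
  guard_total := by
    rintro (_ | l') a i
    · exact ⟨_, Or.inr rfl, rfl, by simp⟩
    · obtain ⟨t, ht, hs, hg⟩ := G.guard_total l' a i
      exact ⟨_, Or.inl ⟨t, ht, rfl⟩, by simp [hs], hg⟩
  guard_disjoint := by
    rintro _ (⟨t₁, h₁, rfl⟩ | rfl) _ (⟨t₂, h₂, rfl⟩ | rfl) hs hne a i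
    · exact G.guard_disjoint t₁ h₁ t₂ h₂ (Option.some.inj hs) hne a i
    · simp at hs
    · simp at hs
    · exact absurd rfl hne
  tgt_unique := by
    rintro _ (⟨t₁, h₁, rfl⟩ | rfl) _ (⟨t₂, h₂, rfl⟩ | rfl) hs hg hu
    · have := G.tgt_unique t₁ h₁ t₂ h₂ (Option.some.inj hs) hg hu
      simp [this]
    · simp at hs
    · simp at hs
    · rfl
  no_dead_end := by
    rintro (_ | l') a ha
    · obtain ⟨t, ht, hs, i, -, -⟩ := G.no_dead_end l a ha
      exact ⟨_, Or.inr rfl, rfl, i, by simp, by simpa using ha⟩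
    · obtain ⟨t, ht, hs, i, hg, hi⟩ := G.no_dead_end l' a ha
      refine ⟨_, Or.inl ⟨t, ht, rfl⟩, by simp [hs], i, hg, ?_⟩
      by_cases h : t.tgt = l
      · subst h
        simpa using hi
      · simpa [h] using hi

end ProgramGame

/-! ## Symbolic domain and controllable predecessors -/

section Symbolic

variable {L : FirstOrder.Language.{u, v}} {V : Type y} [L.Structure V] {I : Type w} {m : ℕ} {Loc : Type x}

/-- The symbolic domain `𝒟`: a formula over the program variables for every location. -/
abbrev Dom (L : FirstOrder.Language.{u, v}) (m : ℕ) (Loc : Type x) : Type _ := Loc → L.Formula (Fin m)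

/-- The set of states `⟦d⟧` that a symbolic set represents. -/
def Dom.sem (G : ProgramGame L V I m Loc) (d : Dom L m Loc) : Set G.State :=
  {s | (d s.loc).Realize s.val}

/-- `d₁ ≡ d₂`. -/
def Dom.Equiv (G : ProgramGame L V I m Loc) (d₁ d₂ : Dom L m Loc) : Prop :=
  d₁.sem G = d₂.sem G

/-- Formulas of `L`, read in an extended language `L₁` with additional constants `C`. -/
def embed {L₁ : FirstOrder.Language.{u, v}} (ι : L →ᴸ L₁) (C : Type) {α β : Type*} (f : α → β)
    (φ : L.Formula α) : L₁.Formula (C ⊕ β) :=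
  (ι.onFormula φ).relabel (fun a => Sum.inr (f a))

/-- A formula over the variables in `α ⊕ I` together with constants, regrouped. -/
def regroup {L₁ : FirstOrder.Language.{u, v}} {C : Type} {α J : Type*}
    (φ : L₁.Formula (C ⊕ (α ⊕ J))) : L₁.Formula ((C ⊕ α) ⊕ J) :=
  φ.relabel (fun a => (Equiv.sumAssoc C α J).symm a)

/-- `φ[u]`: the simultaneous replacement of the program variables `z` by the terms `u z`.
The additional constants `C` are not affected. -/
def applyUpdate {L₁ : FirstOrder.Language.{u, v}} (ι : L →ᴸ L₁) {C : Type}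
    (f : Fin m → L.Term (Fin m ⊕ I)) (φ : L₁.Formula (C ⊕ Fin m)) :
    L₁.Formula ((C ⊕ Fin m) ⊕ I) :=
  φ.subst (Sum.elim (fun c => Term.var (Sum.inl (Sum.inl c)))
    (fun z => (ι.onTerm (f z)).relabel (Sum.map Sum.inr id)))

variable [Finite I]

/-- The symbolic controllable predecessor, for symbolic sets in which additional predicate symbols
(from `L₁`) and additional constants (from `C`) may occur. -/
noncomputable def cpreExt {L₁ : FirstOrder.Language.{u, v}} (ι : L →ᴸ L₁) {C : Type}
    (G : ProgramGame L V I m Loc) (p : Player) (d : Loc → L₁.Formula (C ⊕ Fin m)) :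
    Loc → L₁.Formula (C ⊕ Fin m) := fun l =>
  match p with
  | .env => embed ι C id (G.inv l) ⊓ Formula.iExs I
      (Formula.iInf fun t : G.Out l =>
        (regroup (embed ι C id t.1.guard) ⊓
          applyUpdate ι t.1.update (embed ι C id (G.inv t.1.tgt))).imp
          (applyUpdate ι t.1.update (d t.1.tgt)))
  | .sys => embed ι C id (G.inv l) ⊓ Formula.iAlls I
      (Formula.iSup fun t : G.Out l =>
        regroup (embed ι C id t.1.guard) ⊓
          applyUpdate ι t.1.update (embed ι C id (G.inv t.1.tgt)) ⊓
          applyUpdate ι t.1.update (d t.1.tgt))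

/-- The symbolic controllable predecessor `CPre_{G,p} : 𝒟 → 𝒟` (no additional symbols). -/
noncomputable def cpre (G : ProgramGame L V I m Loc) (p : Player) (d : Dom L m Loc) :
    Dom L m Loc := fun l =>
  (cpreExt (LHom.id L) (C := Empty) G p (fun l' => embed (LHom.id L) Empty id (d l')) l).relabel
    (Sum.elim Empty.elim id)

end Symbolic

/-! ## Acceleration lemmas and uninterpreted lemma symbols -/

/-- Acceleration lemmas over the program variables. In `step`, the left variables are the current
ones and the right variables are the primed ones. -/
structure AccLemma (L : FirstOrder.Language.{u, v}) (V : Type y) [L.Structure V] (m : ℕ) where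
  base : L.Formula (Fin m)
  step : L.Formula (Fin m ⊕ Fin m)
  conc : L.Formula (Fin m)
  reaches : ∀ α : ℕ → Fin m → V, conc.Realize (α 0) →
    (∀ i, step.Realize (Sum.elim (α i) (α (i + 1)))) → ∃ k, base.Realize (α k)
  preserves : ∀ a : Fin m → V, conc.Realize a → ¬ base.Realize a →
    ∀ a' : Fin m → V, step.Realize (Sum.elim a a') → conc.Realize a'

/-- The uninterpreted predicate symbols: the `k`-th triple `(b, st, c)` of lemma symbols, of
arities `m`, `m + m` and `m`. -/
inductive LemmaSymb (m : ℕ) : ℕ → Type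
  | b (k : ℕ) : LemmaSymb m m
  | st (k : ℕ) : LemmaSymb m (m + m)
  | c (k : ℕ) : LemmaSymb m m

/-- The language of the lemma symbols. -/
def lemmaLang (m : ℕ) : FirstOrder.Language.{0, 0} where
  Functions _ := Empty
  Relations := LemmaSymb m

/-- The language of the game together with the lemma symbols. -/
abbrev ULang (L : FirstOrder.Language.{u, v}) (m : ℕ) : FirstOrder.Language.{u, v} := L.sum (lemmaLang m)

/-- The uninterpreted constants: `(k, z)` is the constant `e_z` of the `k`-th set `E`. -/
abbrev UConst (m : ℕ) : Type := ℕ × Fin m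

/-- Constraints: formulas without free variables, in which lemma symbols and uninterpreted
constants may occur. -/
abbrev Constr (L : FirstOrder.Language.{u, v}) (m : ℕ) : Type _ := (ULang L m).Formula (UConst m)

/-- Formulas over the program variables, in which lemma symbols and uninterpreted constants may
occur. -/
abbrev UForm (L : FirstOrder.Language.{u, v}) (m : ℕ) : Type _ := (ULang L m).Formula (UConst m ⊕ Fin m)

/-- Symbolic sets in which lemma symbols and uninterpreted constants may occur. -/
abbrev UDom (L : FirstOrder.Language.{u, v}) (m : ℕ) (Loc : Type x) : Type _ := Loc → UForm L m

section Uninterpreted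

variable {L : FirstOrder.Language.{u, v}} {V : Type y} [L.Structure V] {m : ℕ}

/-- Terms contain no lemma symbols. -/
def instTerm {α : Type*} : (ULang L m).Term α → L.Term α
  | .var a => .var a
  | .func (l := n) f ts =>
    match (show L.Functions n ⊕ Empty from f) with
    | .inl f => .func f (fun i => instTerm (ts i))
    | .inr e => e.elim

/-- `φ[lam]`: every atom `b(t)`, `st(t, t')`, `c(t)` of the `k`-th lemma triple is replaced by
`base[x ↦ t]`, `step[x ↦ t, x' ↦ t']`, `conc[x ↦ t]` of the acceleration lemma `lam k`. -/
def instLemma (lam : ℕ → AccLemma L V m) {α : Type*} :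
    {n : ℕ} → (ULang L m).BoundedFormula α n → L.BoundedFormula α n
  | _, .falsum => .falsum
  | _, .equal t₁ t₂ => .equal (instTerm t₁) (instTerm t₂)
  | n, .rel (l := r) R ts =>
    match (show L.Relations r ⊕ LemmaSymb m r from R) with
    | .inl R => .rel R (fun i => instTerm (ts i))
    | .inr S =>
      let ts' : Fin r → L.Term (α ⊕ Fin n) := fun i => instTerm (ts i)
      match r, S, ts' with
      | _, .b k, ts' => BoundedFormula.relabel (k := 0) id ((lam k).base.subst ts')
      | _, .st k, ts' => BoundedFormula.relabel (k := 0) id ((lam k).step.subst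
          (Sum.elim (fun z => ts' (Fin.castAdd m z)) (fun z => ts' (Fin.natAdd m z))))
      | _, .c k, ts' => BoundedFormula.relabel (k := 0) id ((lam k).conc.subst ts')
  | _, .imp φ ψ => .imp (instLemma lam φ) (instLemma lam ψ)
  | _, .all φ => .all (instLemma lam φ)

/-- A formula of the game's language, as a formula in the extended language. -/
def lift (φ : L.Formula (Fin m)) : UForm L m := embed LHom.sumInl (UConst m) id φ

/-- The atom `b(X)` of the `k`-th lemma triple. -/
def atomB (k : ℕ) : UForm L m :=
  Relations.formula (L := ULang L m) (Sum.inr (LemmaSymb.b k)) (fun z => Term.var (Sum.inr z))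

/-- The atom `st(E, X)` of the `k`-th lemma triple and the `k`-th set `E` of constants. -/
def atomSt (k : ℕ) : UForm L m :=
  Relations.formula (L := ULang L m) (Sum.inr (LemmaSymb.st k))
    (Fin.append (fun z => Term.var (Sum.inl (k, z))) (fun z => Term.var (Sum.inr z)))

/-- The formula `c(X)` of the `k`-th lemma triple. -/
def atomC (k : ℕ) : (ULang L m).Formula (Fin m) :=
  Relations.formula (L := ULang L m) (Sum.inr (LemmaSymb.c k)) (fun z => Term.var z)

/-- A formula without uninterpreted constants, as one in which they may occur. -/
def weaken (φ : (ULang L m).Formula (Fin m)) : UForm L m := φ.relabel Sum.inr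

/-- The substitution `[E ↦ X]` for the `k`-th set `E` of constants, on constants. -/
def constToVar (k : ℕ) (e : UConst m) : UConst m ⊕ Fin m :=
  if e.1 = k then Sum.inr e.2 else Sum.inl e

/-- `Ψ[E ↦ X]` for the `k`-th set `E` of constants. -/
def Constr.close (k : ℕ) (Ψ : Constr L m) : UForm L m := Ψ.relabel (constToVar k)

/-- `φ[E ↦ X]` for the `k`-th set `E` of constants. -/
def UForm.close (k : ℕ) (φ : UForm L m) : UForm L m :=
  φ.relabel (Sum.elim (constToVar k) Sum.inr)

/-- `InstantiateLemmas(Ψ, φ)` may return `χ`: either lemmas `lam` are found that make `Ψ[lam]`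
valid, and `χ` is `φ[lam]`, or none are found, and `χ` is `⊥`. -/
def InstantiateLemmas (V : Type y) [L.Structure V] (Ψ : Constr L m)
    (φ : (ULang L m).Formula (Fin m)) (χ : L.Formula (Fin m)) : Prop :=
  (∃ lam : ℕ → AccLemma L V m,
    (∀ ε : UConst m → V, Formula.Realize (instLemma lam Ψ) ε) ∧ χ = instLemma lam φ) ∨ χ = ⊥

end Uninterpreted

/-! ## The accelerated procedures

Procedures that need not terminate and that consult arbitrary heuristics (`Iterate?`,
`Accelerate?`, `AccelBuchi?`, and the search for lemmas) are described by the relation between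
arguments and results of their terminating runs; every possible answer of a heuristic is a
possible run. Fresh lemma symbols and constants are picked by means of a counter: the argument `n`
before the outputs is the first unused index, the last argument is the first unused index
afterwards. -/

section Procedures

variable {L : FirstOrder.Language.{u, v}} {V : Type y} [L.Structure V] {I : Type w} [Finite I] {m : ℕ}

/-- `CPre` on symbolic sets with lemma symbols and uninterpreted constants. -/
noncomputable abbrev ucpre {Loc : Type x} (G : ProgramGame L V I m Loc) (p : Player)
    (d : UDom L m Loc) : UDom L m Loc :=
  cpreExt (L₁ := ULang L m) LHom.sumInl (C := UConst m) G p d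

/-- `Precise(G, p, a)`: at every location, `CPre(a)` implies `a`. -/
noncomputable def Precise {Loc : Type x} (G : ProgramGame L V I m Loc) (p : Player)
    (a : UDom L m Loc) : Constr L m :=
  haveI := G.loc_finite
  Formula.iInf fun l : Loc => Formula.iAlls (Fin m) ((ucpre G p a l).imp (a l))

/-- The symbolic set `d ∪ {l_End ↦ φ}` in a loop game. -/
def extendEnd {Loc : Type x} (d : UDom L m Loc) (φ : UForm L m) : UDom L m (Option Loc) :=
  fun o => o.elim φ d

/-- The constraint that `AccA` builds from the results `Ψrec`, `a` of `IterA` in the loop game: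
`(∀ X. Inv(l) ∧ b(X) → d(l)) ∧ (∀ X. Inv(l) ∧ ¬ d(l) ∧ c(X) → Ψrec[E ↦ X] ∧ a(l)[E ↦ X])`. -/
noncomputable def accAConstr {Loc : Type x} (G : ProgramGame L V I m Loc) (l : Loc)
    (d : UDom L m Loc) (k : ℕ) (Ψrec : Constr L m) (a : UDom L m (Option Loc)) : Constr L m :=
  Formula.iAlls (Fin m) ((lift (G.inv l) ⊓ atomB k).imp (d l)) ⊓
  Formula.iAlls (Fin m) ((lift (G.inv l) ⊓ (d l).not ⊓ weaken (atomC k)).imp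
    (Constr.close k Ψrec ⊓ UForm.close k (a (some l))))

/-- The constraint that `AccB` builds from the results `Ψrec`, `a` of `IterB` in the loop game:
`(∀ X. Inv(l) ∧ b(X) → ¬ f(l)) ∧ (∀ X. Inv(l) ∧ f(l) ∧ c(X) → Ψrec[E ↦ X] ∧ a(l)[E ↦ X])`. -/
noncomputable def accBConstr {Loc : Type x} (G : ProgramGame L V I m Loc) (l : Loc)
    (f : UDom L m Loc) (k : ℕ) (Ψrec : Constr L m) (a : UDom L m (Option Loc)) : Constr L m :=
  Formula.iAlls (Fin m) ((lift (G.inv l) ⊓ atomB k).imp (f l).not) ⊓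
  Formula.iAlls (Fin m) ((lift (G.inv l) ⊓ f l ⊓ weaken (atomC k)).imp
    (Constr.close k Ψrec ⊓ UForm.close k (a (some l))))

/-- The formula `c(X) ∧ Inv(l)` that `AccA` and `AccB` return. -/
def accFormula {Loc : Type x} (G : ProgramGame L V I m Loc) (l : Loc) (k : ℕ) :
    (ULang L m).Formula (Fin m) :=
  atomC k ⊓ LHom.sumInl.onFormula (G.inv l)

mutual

/-- `IterA(G, p, Ψ, d)` returns `(Ψ', d')`. -/
inductive IterA : {Loc : Type x} → ProgramGame L V I m Loc → Player → Constr L m → UDom L m Loc →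
    ℕ → Constr L m → UDom L m Loc → ℕ → Prop
  | finish {Loc : Type x} (G : ProgramGame L V I m Loc) (p : Player) (Ψ : Constr L m)
      (d : UDom L m Loc) (n : ℕ) : IterA G p Ψ d n Ψ d n
  | accelerate {Loc : Type x} {G : ProgramGame L V I m Loc} {p : Player} {Ψ Ψrec Ψ' : Constr L m}
      {d d' : UDom L m Loc} {n n₁ n' : ℕ} {l : Loc} {φ : (ULang L m).Formula (Fin m)} :
      AccA G p l d n Ψrec φ n₁ →
      IterA G p (Ψ ⊓ Ψrec) (open Classical in Function.update d l (d l ⊔ weaken φ)) n₁ Ψ' d' n' →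
      IterA G p Ψ d n Ψ' d' n'
  | iterate {Loc : Type x} {G : ProgramGame L V I m Loc} {p : Player} {Ψ Ψ' : Constr L m}
      {d d' : UDom L m Loc} {n n' : ℕ} :
      IterA G p Ψ (fun l => d l ⊔ ucpre G p d l) n Ψ' d' n' →
      IterA G p Ψ d n Ψ' d' n'

/-- `AccA(G, p, l, d)` returns `(Ψ, φ)`. -/
inductive AccA : {Loc : Type x} → ProgramGame L V I m Loc → Player → Loc → UDom L m Loc →
    ℕ → Constr L m → (ULang L m).Formula (Fin m) → ℕ → Prop
  | intro {Loc : Type x} {G : ProgramGame L V I m Loc} {p : Player} {l : Loc}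
      {d : UDom L m Loc} {n n' : ℕ} {Ψrec : Constr L m} {a : UDom L m (Option Loc)} :
      IterA (G.loop l) p ⊤ (extendEnd d (atomSt n)) (n + 1) Ψrec a n' →
      AccA G p l d n (accAConstr G l d n Ψrec a) (accFormula G l n) n'

end

mutual

/-- `IterB(G, p, Ψ, f, w)` returns `(Ψ', w')`, where `B` is the set of accepting locations. -/
inductive IterB : {Loc : Type x} → ProgramGame L V I m Loc → Set Loc → Player → Constr L m →
    UDom L m Loc → UDom L m Loc → ℕ → Constr L m → UDom L m Loc → ℕ → Prop
  | finish {Loc : Type x} (G : ProgramGame L V I m Loc) (B : Set Loc) (p : Player)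
      (Ψ : Constr L m) (f w : UDom L m Loc) (n : ℕ) : IterB G B p Ψ f w n Ψ w n
  | accelerate {Loc : Type x} {G : ProgramGame L V I m Loc} {B : Set Loc} {p : Player}
      {Ψ Ψ₁ Ψ₂ Ψ₃ Ψ' : Constr L m} {f a w w₁ f₁ w' : UDom L m Loc} {n n₁ n₂ n₃ n' : ℕ} {l : Loc}
      {φ : (ULang L m).Formula (Fin m)} :
      IterA G p Ψ f n Ψ₁ a n₁ →
      IterA G p.opp Ψ (fun l => lift (G.inv l) ⊓ (ucpre G p a l).not) n₁ Ψ₂ w₁ n₂ →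
      f₁ = (fun l => f l ⊓ (lift (G.inv l) ⊓ (w₁ l).not)) →
      l ∈ B →
      AccB G B p l f₁ n₂ Ψ₃ φ n₃ →
      IterB G B p (Ψ ⊓ (Ψ₁ ⊓ Precise G p a) ⊓ Ψ₂ ⊓ Ψ₃)
        (open Classical in Function.update f₁ l (f₁ l ⊓ (weaken φ).not))
        (open Classical in Function.update w₁ l (w₁ l ⊔ weaken φ)) n₃ Ψ' w' n' →
      IterB G B p Ψ f w n Ψ' w' n'
  | iterate {Loc : Type x} {G : ProgramGame L V I m Loc} {B : Set Loc} {p : Player}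
      {Ψ Ψ₁ Ψ₂ Ψ' : Constr L m} {f a w w₁ f₁ w' : UDom L m Loc} {n n₁ n₂ n' : ℕ} :
      IterA G p Ψ f n Ψ₁ a n₁ →
      IterA G p.opp Ψ (fun l => lift (G.inv l) ⊓ (ucpre G p a l).not) n₁ Ψ₂ w₁ n₂ →
      f₁ = (fun l => f l ⊓ (lift (G.inv l) ⊓ (w₁ l).not)) →
      IterB G B p (Ψ ⊓ (Ψ₁ ⊓ Precise G p a) ⊓ Ψ₂) f₁ w₁ n₂ Ψ' w' n' →
      IterB G B p Ψ f w n Ψ' w' n'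

/-- `AccB(G, p, l, f)` returns `(Ψ, φ)`. In the loop game, `l_End` is an accepting location, too. -/
inductive AccB : {Loc : Type x} → ProgramGame L V I m Loc → Set Loc → Player → Loc →
    UDom L m Loc → ℕ → Constr L m → (ULang L m).Formula (Fin m) → ℕ → Prop
  | intro {Loc : Type x} {G : ProgramGame L V I m Loc} {B : Set Loc} {p : Player} {l : Loc}
      {f : UDom L m Loc} {n n' : ℕ} {Ψrec : Constr L m} {a : UDom L m (Option Loc)} :
      IterB (G.loop l) (insert none (some '' B)) p ⊤ (extendEnd f (atomSt n).not) (fun _ => ⊥)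
        (n + 1) Ψrec a n' →
      AccB G B p l f n (accBConstr G l f n Ψrec a) (accFormula G l n) n'

end

variable {Loc : Type x}

/-- The optional acceleration step of `AttractorAcc`, which turns `a` into `a'`. -/
def AttractorAccelStep (G : ProgramGame L V I m Loc) (p : Player) (a a' : Dom L m Loc) : Prop :=
  a' = a ∨ ∃ (l : Loc) (Ψ : Constr L m) (φ : (ULang L m).Formula (Fin m)) (n : ℕ)
    (χ : L.Formula (Fin m)),
    AccA G p l (fun l' => lift (a l')) 0 Ψ φ n ∧ InstantiateLemmas V Ψ φ χ ∧
    a' = (open Classical in Function.update a l (a l ⊔ χ))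

/-- The loop of `AttractorAcc`, entered with `aⁿ⁻¹` and `aⁿ`, returns the last argument. -/
inductive AttractorLoop (G : ProgramGame L V I m Loc) (p : Player) :
    Dom L m Loc → Dom L m Loc → Dom L m Loc → Prop
  | done {a₀ a : Dom L m Loc} : a.Equiv G a₀ → AttractorLoop G p a₀ a a
  | next {a₀ a a' r : Dom L m Loc} : ¬ a.Equiv G a₀ → AttractorAccelStep G p a a' →
      AttractorLoop G p a' (fun l => a' l ⊔ cpre G p a' l) r → AttractorLoop G p a₀ a r

/-- `AttractorAcc(G, p, d)` terminates and returns `r`. -/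
def AttractorAcc (G : ProgramGame L V I m Loc) (p : Player) (d r : Dom L m Loc) : Prop :=
  AttractorLoop G p (fun _ => ⊥) d r

/-- The optional co-Büchi acceleration step of `SolveBuchiAcc`, at an accepting location, which
turns `w` into `w'`. -/
def BuchiAccelStep (G : ProgramGame L V I m Loc) (B : Set Loc) (p : Player)
    (f w w' : Dom L m Loc) : Prop :=
  w' = w ∨ ∃ l ∈ B, ∃ (Ψ : Constr L m) (φ : (ULang L m).Formula (Fin m)) (n : ℕ)
    (χ : L.Formula (Fin m)),
    AccB G B p l (fun l' => lift (f l' ⊓ (G.inv l' ⊓ (w l').not))) 0 Ψ φ n ∧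
    InstantiateLemmas V Ψ φ χ ∧
    w' = (open Classical in Function.update w l (w l ⊔ χ))

/-- The loop of `SolveBuchiAcc`, entered with `fⁿ⁻¹`, `fⁿ` and `wⁿ⁻¹`, returns the last
argument. -/
inductive SolveBuchiLoop (G : ProgramGame L V I m Loc) (B : Set Loc) (p : Player) :
    Dom L m Loc → Dom L m Loc → Dom L m Loc → Dom L m Loc → Prop
  | done {f₀ f w : Dom L m Loc} : f.Equiv G f₀ → SolveBuchiLoop G B p f₀ f w w
  | next {f₀ f w₀ a w w' r : Dom L m Loc} : ¬ f.Equiv G f₀ →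
      AttractorAcc G p f a →
      AttractorAcc G p.opp (fun l => (cpre G p a l).not) w →
      BuchiAccelStep G B p f w w' →
      SolveBuchiLoop G B p f (fun l => f l ⊓ (G.inv l ⊓ (w' l).not)) w' r →
      SolveBuchiLoop G B p f₀ f w₀ r

/-- `SolveBuchiAcc(G, p, f)` terminates and returns `r`, where co-Büchi acceleration is attempted
only at the accepting locations `B`. -/
def SolveBuchiAcc (G : ProgramGame L V I m Loc) (B : Set Loc) (p : Player)
    (f r : Dom L m Loc) : Prop :=
  SolveBuchiLoop G B p (fun _ => ⊤) f (fun _ => ⊥) r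

open Classical in
/-- The symbolic set `{l ↦ Inv(l) | l ∈ B}`. -/
noncomputable def acceptingDom (G : ProgramGame L V I m Loc) (B : Set Loc) : Dom L m Loc :=
  fun l => if l ∈ B then G.inv l else ⊥

end Procedures

end ReactiveGame

-- Let `K` be the nested fixed point `μY. νX. pre(Y) ∪ (pre(X) \ B)` for the opponent of `p`; this
-- is `coBuchiRegion` with empty target. A nonempty target `T` adds the option of reaching `T`. The
-- proof compares the result with `K`, and `K` with the winning region.
--
-- Two invariants of the main loop give `w ⊆ K`: the current `w` lies in `K`, and so does every
-- configuration of `B` that has been removed from `f`. If `a` contains `f` and `p` cannot enter `a`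
-- from outside, the opponent can stay outside `a`, where every visit to `B` is a visit to `B \ f`,
-- hence to `K` (`attr_opp_subset_coBuchiRegion`). Conversely, on termination `f` avoids `w`, so
-- from `f` player `p` can always return to `f ⊆ B`, and `K ⊆ w` follows
-- (`coBuchiRegion_opp_subset`).
--
-- Acceleration rests on `IsAccTriple.conc_subset`. If some configuration satisfying `conc` were
-- outside the region, the constraint on the loop game would supply a `step` successor that is
-- outside as well, and so on forever without meeting `base`. The link to the loop game is that
-- identifying `l_End` with `l` maps loop-game regions into regions of the game itself
-- (`loop_attr_subset`, `loop_coBuchiRegion_subset`).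
--
-- The symbolic procedures are proved sound for every interpretation of the lemma symbols by
-- acceleration triples and every value of the constants `E`, by mutual induction over their runs.
-- `realize_instLemma` then turns syntactic instantiation of lemmas into such an interpretation.
-- Formulas may hold outside the invariants, which explains the intersections with `invSet`.
--
-- That `K` is the winning region is shown with ordinal ranks: memoryless strategies for both sides,
-- and disjointness of the two winning regions (`winning_coBuchi`).

namespace ReactiveGame

open FirstOrder FirstOrder.Language

universe u v w x y

/-! ## Semantic controllable predecessors -/

section Pre

variable {L : FirstOrder.Language.{u, v}} {V : Type y} [L.Structure V] {I : Type w} {m : ℕ}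
  {Loc : Type x}

namespace ProgramGame

/-- The configurations that satisfy the location invariants. -/
def invSet (G : ProgramGame L V I m Loc) : Set (Loc × (Fin m → V)) :=
  {s | (G.inv s.1).Realize s.2}

/-- The effect of a transition on an assignment. -/
def _root_.ReactiveGame.Transition.apply (t : Transition L I m Loc) (a : Fin m → V) (i : I → V) :
    Fin m → V :=
  fun z => (t.update z).realize (Sum.elim a i)

/-- Transition `t` is permitted in configuration `s` under input `i`. -/
def Permits (G : ProgramGame L V I m Loc) (s : Loc × (Fin m → V)) (i : I → V)
    (t : Transition L I m Loc) : Prop :=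
  t ∈ G.δ ∧ t.src = s.1 ∧ t.guard.Realize (Sum.elim s.2 i) ∧
    (t.tgt, t.apply s.2 i) ∈ G.invSet

/-- The controllable predecessors of a set of configurations. -/
def pre (G : ProgramGame L V I m Loc) (p : Player) (R : Set (Loc × (Fin m → V))) :
    Set (Loc × (Fin m → V)) :=
  match p with
  | .env => {s | s ∈ G.invSet ∧ ∃ i : I → V, ∀ t, G.Permits s i t → (t.tgt, t.apply s.2 i) ∈ R}
  | .sys => {s | s ∈ G.invSet ∧ ∀ i : I → V, ∃ t, G.Permits s i t ∧ (t.tgt, t.apply s.2 i) ∈ R}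

variable (G : ProgramGame L V I m Loc) (p : Player) {R R' : Set (Loc × (Fin m → V))}

theorem pre_subset_invSet : G.pre p R ⊆ G.invSet := by
  cases p <;> exact fun s h => h.1

/-- A permitted transition ends inside the invariants, so only that part of the target set matters.
-/
theorem pre_mono_on (h : R ∩ G.invSet ⊆ R') : G.pre p R ⊆ G.pre p R' := by
  cases p
  · rintro s ⟨hs, i, hi⟩
    exact ⟨hs, i, fun t ht => h ⟨hi t ht, ht.2.2.2⟩⟩
  · rintro s ⟨hs, hi⟩
    refine ⟨hs, fun i => ?_⟩
    obtain ⟨t, ht, hR⟩ := hi i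
    exact ⟨t, ht, h ⟨hR, ht.2.2.2⟩⟩

theorem pre_mono (h : R ⊆ R') : G.pre p R ⊆ G.pre p R' :=
  G.pre_mono_on p (Set.inter_subset_left.trans h)

/-- One-step determinacy. Both clauses of `pre` count an input that blocks all transitions in favour
of the environment, so they are dual even without input-enabledness. -/
theorem mem_pre_opp_compl {s : Loc × (Fin m → V)} (hs : s ∈ G.invSet) :
    s ∈ G.pre p.opp Rᶜ ↔ s ∉ G.pre p R := by
  cases p <;> simp only [pre, Player.opp, Set.mem_ofPred_eq, hs, true_and, Set.mem_compl_iff] <;>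
    push Not <;> rfl

/-- The projection of the loop game to the game that identifies `l_End` with `l`. -/
noncomputable def unloop (l : Loc) (Y : Set (Option Loc × (Fin m → V))) :
    Set (Loc × (Fin m → V)) :=
  open Classical in {s | (if s.1 = l then none else some s.1, s.2) ∈ Y}

/-- Since `l_End` carries the invariant of `l`, redirection does not affect which transitions are
permitted. -/
theorem loop_inv_redirect (l l' : Loc) :
    (G.loop l).inv (open Classical in if l' = l then none else some l') = G.inv l' := by
  by_cases h : l' = l
  · subst h
    simp [loop]
  · simp [loop, h]

theorem loop_permits_some_iff {l l' : Loc} {a : Fin m → V} {i : I → V}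
    {t : Transition L I m (Option Loc)} :
    (G.loop l).Permits (some l', a) i t ↔ ∃ t₀, G.Permits (l', a) i t₀ ∧
      t = ⟨some t₀.src, t₀.guard, t₀.update,
        open Classical in if t₀.tgt = l then none else some t₀.tgt⟩ := by
  constructor
  · rintro ⟨⟨t₀, ht₀, rfl⟩ | rfl, hs, hg, hi⟩
    · refine ⟨t₀, ⟨ht₀, Option.some.inj hs, hg, ?_⟩, rfl⟩
      have hi : Formula.Realize _ (t₀.apply a i) := hi
      rwa [loop_inv_redirect] at hi
    · simp at hs
  · rintro ⟨t₀, ⟨ht₀, hs, hg, hi⟩, rfl⟩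
    refine ⟨Or.inl ⟨t₀, ht₀, rfl⟩, congrArg some hs, hg, ?_⟩
    change Formula.Realize _ (t₀.apply a i)
    rwa [loop_inv_redirect]

theorem mem_loop_pre_some {l l' : Loc} {a : Fin m → V} {Y : Set (Option Loc × (Fin m → V))} :
    (some l', a) ∈ (G.loop l).pre p Y ↔ (l', a) ∈ G.pre p (unloop l Y) := by
  cases p
  · refine and_congr Iff.rfl (exists_congr fun i => ?_)
    constructor
    · exact fun h t ht => h _ (G.loop_permits_some_iff.2 ⟨t, ht, rfl⟩)
    · intro h t ht
      obtain ⟨t₀, ht₀, rfl⟩ := G.loop_permits_some_iff.1 ht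
      exact h t₀ ht₀
  · refine and_congr Iff.rfl (forall_congr' fun i => ?_)
    constructor
    · rintro ⟨t, ht, h⟩
      obtain ⟨t₀, ht₀, rfl⟩ := G.loop_permits_some_iff.1 ht
      exact ⟨t₀, ht₀, h⟩
    · rintro ⟨t, ht, h⟩
      exact ⟨_, G.loop_permits_some_iff.2 ⟨t, ht, rfl⟩, h⟩

theorem loop_pre_none {l : Loc} {a : Fin m → V} {Y : Set (Option Loc × (Fin m → V))}
    (h : (none, a) ∈ (G.loop l).pre p Y) : (none, a) ∈ Y := by
  have hinv : (G.inv l).Realize a := (G.loop l).pre_subset_invSet p h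
  cases p
  · obtain ⟨-, i, hi⟩ := h
    exact hi ⟨none, ⊤, fun z => Term.var (Sum.inl z), none⟩
      ⟨Or.inr rfl, rfl, by simp, hinv⟩
  -- This is only used to obtain some input assignment: `I → V` could be empty a priori.
  · obtain ⟨t, -, -, i, -⟩ := G.no_dead_end l a hinv
    obtain ⟨t', ⟨⟨t₀, ht₀, rfl⟩ | rfl, hs, -⟩, hY⟩ := h.2 i
    · simp at hs
    · exact hY

end ProgramGame

/-! ## Realization of the symbolic controllable predecessors -/

theorem realize_embed {L₁ : FirstOrder.Language.{u, v}} [L₁.Structure V] (ι : L →ᴸ L₁)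
    [ι.IsExpansionOn V] (C : Type) {α β : Type*} (f : α → β) (φ : L.Formula α) (e : C ⊕ β → V) :
    (embed ι C f φ).Realize e ↔ φ.Realize (fun a => e (Sum.inr (f a))) := by
  rw [embed, Formula.realize_relabel, LHom.realize_onFormula]
  rfl

theorem realize_applyUpdate {L₁ : FirstOrder.Language.{u, v}} [L₁.Structure V] (ι : L →ᴸ L₁)
    [ι.IsExpansionOn V] {C : Type} (t : Transition L I m Loc) (φ : L₁.Formula (C ⊕ Fin m))
    (e : C → V) (a : Fin m → V) (i : I → V) :
    (applyUpdate ι t.update φ).Realize (Sum.elim (Sum.elim e a) i) ↔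
      φ.Realize (Sum.elim e (t.apply a i)) := by
  rw [applyUpdate, Formula.Realize, BoundedFormula.realize_subst]
  refine iff_of_eq (congrArg (fun f => BoundedFormula.Realize φ f default) (funext ?_))
  rintro (c | z)
  · rfl
  · simp only [Sum.elim_inr, Term.realize_relabel, LHom.realize_onTerm, Transition.apply]
    congr 1
    funext j
    cases j <;> rfl

theorem realize_regroup {L₁ : FirstOrder.Language.{u, v}} [L₁.Structure V] (ι : L →ᴸ L₁)
    [ι.IsExpansionOn V] {C : Type} (φ : L.Formula (Fin m ⊕ I))
    (e : C → V) (a : Fin m → V) (i : I → V) :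
    (regroup (embed ι C id φ)).Realize (Sum.elim (Sum.elim e a) i) ↔
      φ.Realize (Sum.elim a i) := by
  rw [regroup, Formula.realize_relabel, realize_embed]
  refine iff_of_eq (congrArg φ.Realize (funext ?_))
  rintro (c | z) <;> rfl

theorem realize_cpreExt [Finite I] {L₁ : FirstOrder.Language.{u, v}} [L₁.Structure V]
    (ι : L →ᴸ L₁) [ι.IsExpansionOn V] {C : Type} (G : ProgramGame L V I m Loc) (p : Player)
    (d : Loc → L₁.Formula (C ⊕ Fin m)) (e : C → V) (l : Loc) (a : Fin m → V) :
    (cpreExt ι G p d l).Realize (Sum.elim e a) ↔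
      (l, a) ∈ G.pre p {s | (d s.1).Realize (Sum.elim e s.2)} := by
  cases p
  · simp only [cpreExt, Formula.realize_inf, Formula.realize_iExs, Formula.realize_iInf,
      Formula.realize_imp, realize_applyUpdate, realize_regroup, realize_embed, id]
    refine and_congr Iff.rfl (exists_congr fun i => ⟨fun h t ht => ?_, fun h t ht => ?_⟩)
    · exact h ⟨t, ht.1, ht.2.1⟩ ht.2.2
    · exact h t.1 ⟨t.2.1, t.2.2, ht⟩
  · simp only [cpreExt, Formula.realize_inf, Formula.realize_iAlls, Formula.realize_iSup,
      realize_applyUpdate, realize_regroup, realize_embed, id]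
    refine and_congr Iff.rfl (forall_congr' fun i => ⟨?_, ?_⟩)
    · rintro ⟨t, ht, hd⟩
      exact ⟨t.1, ⟨t.2.1, t.2.2, ht⟩, hd⟩
    · rintro ⟨t, ht, hd⟩
      exact ⟨⟨t, ht.1, ht.2.1⟩, ht.2.2, hd⟩

/-- The configurations that a symbolic set represents. -/
def Dom.rawSem (V : Type y) [L.Structure V] (d : Dom L m Loc) : Set (Loc × (Fin m → V)) :=
  {s | (d s.1).Realize s.2}

theorem rawSem_cpre [Finite I] (G : ProgramGame L V I m Loc) (p : Player) (d : Dom L m Loc) :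
    (cpre G p d).rawSem V = G.pre p (d.rawSem V) := by
  ext ⟨l, a⟩
  rw [Dom.rawSem, Set.mem_ofPred_eq, cpre, Formula.realize_relabel]
  have : a ∘ Sum.elim (Empty.elim : Empty → Fin m) id = Sum.elim (Empty.elim) a := by
    funext j
    rcases j with j | j
    · exact j.elim
    · rfl
  rw [this, realize_cpreExt]
  simp only [realize_embed]
  rfl

end Pre

/-! ## Attractors and co-Büchi regions -/

section Regions

variable {L : FirstOrder.Language.{u, v}} {V : Type y} [L.Structure V] {I : Type w} {m : ℕ}
  {Loc : Type x}

namespace ProgramGame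

variable (G : ProgramGame L V I m Loc) (p : Player)

/-- One step of the attractor computation towards `D`. -/
def attrHom (D : Set (Loc × (Fin m → V))) : Set (Loc × (Fin m → V)) →o Set (Loc × (Fin m → V)) where
  toFun X := D ∩ G.invSet ∪ G.pre p X
  monotone' _ _ h := Set.union_subset_union_right _ (G.pre_mono p h)

/-- The attractor of player `p` to `D`. -/
def attr (D : Set (Loc × (Fin m → V))) : Set (Loc × (Fin m → V)) := (G.attrHom p D).lfp

variable {D D' : Set (Loc × (Fin m → V))}

theorem attr_subset {Y : Set (Loc × (Fin m → V))} (hD : D ∩ G.invSet ⊆ Y) (hY : G.pre p Y ⊆ Y) :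
    G.attr p D ⊆ Y :=
  (G.attrHom p D).lfp_le (Set.union_subset hD hY)

theorem attr_eq : G.attr p D = D ∩ G.invSet ∪ G.pre p (G.attr p D) :=
  ((G.attrHom p D).map_lfp).symm

theorem subset_attr : D ∩ G.invSet ⊆ G.attr p D := by
  rw [attr_eq]; exact Set.subset_union_left

theorem pre_attr_subset : G.pre p (G.attr p D) ⊆ G.attr p D := by
  conv_rhs => rw [attr_eq]
  exact Set.subset_union_right

theorem attr_mono (h : D ∩ G.invSet ⊆ D') : G.attr p D ⊆ G.attr p D' :=
  G.attr_subset p (fun _ hs => G.subset_attr p ⟨h hs, hs.2⟩) (G.pre_attr_subset p)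

/-- If all of `D'` that satisfies the invariants lies in the attractor to `D`, then so does the
attractor to `D'`. -/
theorem attr_subset_attr (h : D' ∩ G.invSet ⊆ G.attr p D) : G.attr p D' ⊆ G.attr p D :=
  G.attr_subset p h (G.pre_attr_subset p)

variable (B : Set Loc)

/-- The inner step of the fixed point that defines `coBuchiRegion`. -/
def coBuchiInner (T Y : Set (Loc × (Fin m → V))) :
    Set (Loc × (Fin m → V)) →o Set (Loc × (Fin m → V)) where
  toFun X := T ∩ G.invSet ∪ G.pre p Y ∪ {s | s.1 ∉ B} ∩ G.pre p X
  monotone' _ _ h := Set.union_subset_union_right _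
    (Set.inter_subset_inter_right _ (G.pre_mono p h))

/-- The outer step of the fixed point that defines `coBuchiRegion`. -/
def coBuchiOuter (T : Set (Loc × (Fin m → V))) :
    Set (Loc × (Fin m → V)) →o Set (Loc × (Fin m → V)) where
  toFun Y := (G.coBuchiInner p B T Y).gfp
  monotone' _ _ h := OrderHom.gfp.monotone fun _ => Set.union_subset_union_left _
    (Set.union_subset_union_right _ (G.pre_mono p h))

/-- The region where player `p` can enforce that `T` is reached or that `B` is visited only
finitely often. -/
def coBuchiRegion (T : Set (Loc × (Fin m → V))) : Set (Loc × (Fin m → V)) :=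
  (G.coBuchiOuter p B T).lfp

variable {B} {T T' : Set (Loc × (Fin m → V))}

/-- Coinduction: the region is the greatest fixed point of the inner operator with `Y` set to the
region itself. -/
theorem subset_coBuchiRegion {X : Set (Loc × (Fin m → V))}
    (hX : ∀ s ∈ X, s ∈ T ∩ G.invSet ∨ s ∈ G.pre p (G.coBuchiRegion p B T) ∨
      s.1 ∉ B ∧ s ∈ G.pre p X) : X ⊆ G.coBuchiRegion p B T := by
  have : X ⊆ (G.coBuchiInner p B T (G.coBuchiRegion p B T)).gfp :=
    OrderHom.le_gfp _ fun s hs => by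
      rcases hX s hs with h | h | h
      · exact Or.inl (Or.inl h)
      · exact Or.inl (Or.inr h)
      · exact Or.inr h
  exact this.trans (G.coBuchiOuter p B T).map_lfp.le

/-- Induction for the outer fixed point, with the inner one replaced by an arbitrary post-fixed
point `X`. -/
theorem coBuchiRegion_subset {Y : Set (Loc × (Fin m → V))}
    (hY : ∀ X, (∀ s ∈ X, s ∈ T ∩ G.invSet ∨ s ∈ G.pre p Y ∨ s.1 ∉ B ∧ s ∈ G.pre p X) → X ⊆ Y) :
    G.coBuchiRegion p B T ⊆ Y := by
  refine (G.coBuchiOuter p B T).lfp_le (hY _ fun s hs => ?_)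
  have hs : s ∈ (G.coBuchiInner p B T Y).gfp := hs
  rw [← (G.coBuchiInner p B T Y).map_gfp] at hs
  rcases hs with (h | h) | h
  · exact Or.inl h
  · exact Or.inr (Or.inl h)
  · exact Or.inr (Or.inr h)

theorem target_subset_coBuchiRegion : T ∩ G.invSet ⊆ G.coBuchiRegion p B T :=
  G.subset_coBuchiRegion p fun _ hs => Or.inl hs

theorem pre_coBuchiRegion_subset :
    G.pre p (G.coBuchiRegion p B T) ⊆ G.coBuchiRegion p B T :=
  G.subset_coBuchiRegion p fun _ hs => Or.inr (Or.inl hs)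

theorem coBuchiRegion_subset_invSet : G.coBuchiRegion p B T ⊆ G.invSet :=
  G.coBuchiRegion_subset p fun X hX s hs => by
    rcases hX s hs with h | h | h
    · exact h.2
    · exact G.pre_subset_invSet p h
    · exact G.pre_subset_invSet p h.2

theorem mem_coBuchiRegion_cases {s : Loc × (Fin m → V)} (hs : s ∈ G.coBuchiRegion p B T) :
    s ∈ T ∩ G.invSet ∨ s ∈ G.pre p (G.coBuchiRegion p B T) := by
  rw [coBuchiRegion, ← (G.coBuchiOuter p B T).map_lfp] at hs
  have hs : s ∈ (G.coBuchiInner p B T (G.coBuchiRegion p B T)).gfp := hs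
  have hfix : (G.coBuchiInner p B T (G.coBuchiRegion p B T)).gfp = G.coBuchiRegion p B T :=
    (G.coBuchiOuter p B T).map_lfp
  rw [← (G.coBuchiInner p B T (G.coBuchiRegion p B T)).map_gfp, hfix] at hs
  rcases hs with (h | h) | h
  · exact Or.inl h
  · exact Or.inr h
  · exact Or.inr h.2

/-- Coinduction up to the co-Büchi region. -/
theorem subset_coBuchiRegion_of_step {X : Set (Loc × (Fin m → V))}
    (hX : ∀ s ∈ X, s ∈ G.coBuchiRegion p B T ∨
      s.1 ∉ B ∧ s ∈ G.pre p (X ∪ G.coBuchiRegion p B T)) :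
    X ⊆ G.coBuchiRegion p B T := by
  have key : ∀ s ∈ G.coBuchiRegion p B T, s ∈ T ∩ G.invSet ∨
      s ∈ G.pre p (G.coBuchiRegion p B T) ∨
      s.1 ∉ B ∧ s ∈ G.pre p (X ∪ G.coBuchiRegion p B T) := fun s hs =>
    (G.mem_coBuchiRegion_cases p hs).imp_right Or.inl
  refine Set.subset_union_left.trans (G.subset_coBuchiRegion p (X := X ∪ G.coBuchiRegion p B T) ?_)
  rintro s (hs | hs)
  · exact (hX s hs).elim (key s) fun h => Or.inr (Or.inr h)
  · exact key s hs

/-- Once `T'` is reached, play continues as in the region for `T`. This lets targets be exchanged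
for others that are already covered. -/
theorem coBuchiRegion_subset_coBuchiRegion (h : T' ∩ G.invSet ⊆ G.coBuchiRegion p B T) :
    G.coBuchiRegion p B T' ⊆ G.coBuchiRegion p B T := by
  refine G.coBuchiRegion_subset p fun X hX => G.subset_coBuchiRegion_of_step p fun s hs => ?_
  rcases hX s hs with h' | h' | h'
  · exact Or.inl (h h')
  · exact Or.inl (G.pre_coBuchiRegion_subset p h')
  · exact Or.inr ⟨h'.1, G.pre_mono p Set.subset_union_left h'.2⟩

/-- If player `p` cannot enter `a` from outside, where `a` covers `f`, then the opponent wins from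
every state that is attracted to a state from which `p` cannot enter `a`. -/
theorem attr_opp_subset_coBuchiRegion {f a : Set (Loc × (Fin m → V))} (hf : f ⊆ a)
    (ha : G.pre p a ⊆ a) (hT : ∀ s ∈ G.invSet, s.1 ∈ B → s ∉ f → s ∈ G.coBuchiRegion p.opp B T) :
    G.attr p.opp (G.pre p a)ᶜ ⊆ G.coBuchiRegion p.opp B T := by
  have hpre : ∀ s ∈ G.invSet, s ∉ G.pre p a → s ∈ G.pre p.opp (aᶜ ∩ G.invSet) := fun s hs h =>
    G.pre_mono_on _ (fun _ h => h) ((G.mem_pre_opp_compl p hs).2 h)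
  -- Outside `a` the opponent can remain outside `a`, because `pre p a ⊆ a`. A visit to `B` there is
  -- outside `f` and falls under `hT`; otherwise `B` is avoided.
  have hX : aᶜ ∩ G.invSet ⊆ G.coBuchiRegion p.opp B T := by
    refine G.subset_coBuchiRegion_of_step _ fun s hs => ?_
    by_cases hB : s.1 ∈ B
    · exact Or.inl (hT s hs.2 hB fun h => hs.1 (hf h))
    · exact Or.inr ⟨hB, G.pre_mono _ Set.subset_union_left (hpre s hs.2 fun h => hs.1 (ha h))⟩
  exact G.attr_subset _ (fun s hs => G.pre_coBuchiRegion_subset _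
    (G.pre_mono _ hX (hpre s hs.2 hs.1))) (G.pre_coBuchiRegion_subset _)

/-! ### Regions of loop games -/

/-- The set of configurations of the loop game that projects to `Y`. -/
def reloop (l : Loc) (Y : Set (Loc × (Fin m → V))) : Set (Option Loc × (Fin m → V)) :=
  {s | (s.1.getD l, s.2) ∈ Y}

theorem unloop_reloop (l : Loc) (Y : Set (Loc × (Fin m → V))) :
    unloop l (reloop l Y) = Y := by
  ext ⟨l', a⟩
  by_cases h : l' = l
  · subst h
    simp [unloop, reloop]
  · simp [unloop, reloop, h]

/-- In `reloop l Y` the location `l_End` is a copy of `l`, so redirection is invisible, and the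
self-loop at `l_End` adds nothing new. -/
theorem loop_pre_reloop_subset {l : Loc} {Y : Set (Loc × (Fin m → V))} (hY : G.pre p Y ⊆ Y) :
    (G.loop l).pre p (reloop l Y) ⊆ reloop l Y := by
  rintro ⟨_ | l', a⟩ h
  · exact G.loop_pre_none p h
  · rw [mem_loop_pre_some, unloop_reloop] at h
    exact hY h

theorem loop_attr_subset {l : Loc} {D : Set (Loc × (Fin m → V))}
    {D' : Set (Option Loc × (Fin m → V))} (h : D' ∩ (G.loop l).invSet ⊆ reloop l (G.attr p D)) :
    (G.loop l).attr p D' ⊆ reloop l (G.attr p D) :=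
  (G.loop l).attr_subset p h (G.loop_pre_reloop_subset p (G.pre_attr_subset p))

/-- It is essential that `l_End` is accepting: otherwise looping there forever would satisfy the
co-Büchi condition although `l` need not be winning. As it is accepting, membership at `l_End` must
come from the target or from the inductively smaller set (`hnone`). The remaining locations follow
by coinduction in the original game. -/
theorem loop_coBuchiRegion_subset {l : Loc} {T : Set (Loc × (Fin m → V))}
    {T' : Set (Option Loc × (Fin m → V))}
    (h : T' ∩ (G.loop l).invSet ⊆ reloop l (G.coBuchiRegion p B T)) :
    (G.loop l).coBuchiRegion p (insert none (some '' B)) T' ⊆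
      reloop l (G.coBuchiRegion p B T) := by
  refine (G.loop l).coBuchiRegion_subset p fun X hX => ?_
  have hpre := G.loop_pre_reloop_subset p (l := l) (G.pre_coBuchiRegion_subset p (B := B) (T := T))
  have hnone : ∀ a, (none, a) ∈ X → (l, a) ∈ G.coBuchiRegion p B T := fun a ha => by
    rcases hX _ ha with h' | h' | h'
    · exact h h'
    · exact hpre h'
    · exact absurd (Set.mem_insert _ _) h'.1
  have hsome : {s | (some s.1, s.2) ∈ X} ⊆ G.coBuchiRegion p B T := by
    refine G.subset_coBuchiRegion_of_step p ?_
    rintro ⟨l', a⟩ ha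
    rcases hX _ ha with h' | h' | ⟨hB, h'⟩
    · exact Or.inl (h h')
    · exact Or.inl (hpre h')
    · refine Or.inr ⟨fun hl => hB (Or.inr ⟨l', hl, rfl⟩), ?_⟩
      rw [mem_loop_pre_some] at h'
      refine G.pre_mono p ?_ h'
      rintro ⟨l₁, a₁⟩ h₁
      by_cases hl : l₁ = l
      · subst hl
        simp only [unloop, Set.mem_ofPred_eq, if_true] at h₁
        exact Or.inr (hnone _ h₁)
      · simp only [unloop, Set.mem_ofPred_eq, if_neg hl] at h₁
        exact Or.inl h₁
  rintro ⟨_ | l', a⟩ ha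
  · exact hnone a ha
  · exact hsome ha

end ProgramGame

end Regions

/-- Acceleration triples, semantically. -/
structure IsAccTriple {α : Type*} (b : α → Prop) (st : α → α → Prop) (c : α → Prop) : Prop where
  reaches : ∀ s : ℕ → α, c (s 0) → (∀ i, st (s i) (s (i + 1))) → ∃ k, b (s k)
  preserves : ∀ a, c a → ¬ b a → ∀ a', st a a' → c a'

/-- If from every element of the conclusion outside of `P`, the base fails and some step leads
outside of `P` again, then the conclusion implies `P`. -/
theorem IsAccTriple.conc_subset {α : Type*} {b : α → Prop} {st : α → α → Prop} {c : α → Prop}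
    (h : IsAccTriple b st c) {P : α → Prop}
    (hP : ∀ a, ¬ P a → c a → ¬ b a ∧ ∃ a', st a a' ∧ ¬ P a') {a : α} (ha : c a) : P a := by
  by_contra hPa
  -- Carrying `c` along with `¬ P` makes the step repeatable; `preserves` applies because `b` fails.
  -- Iterating a choice function contradicts `reaches`.
  have step : ∀ s : {a // ¬ P a ∧ c a}, ∃ s' : {a // ¬ P a ∧ c a}, st s.1 s'.1 := by
    rintro ⟨a, h₁, h₂⟩
    obtain ⟨hb, a', hst, h'⟩ := hP a h₁ h₂
    exact ⟨⟨a', h', h.preserves a h₂ hb a' hst⟩, hst⟩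
  choose next hnext using step
  let s : ℕ → {a // ¬ P a ∧ c a} := fun n => next^[n] ⟨a, hPa, ha⟩
  obtain ⟨k, hk⟩ := h.reaches (fun n => (s n).1) ha fun i => by
    simpa only [s, Function.iterate_succ_apply'] using hnext (s i)
  exact (hP _ (s k).2.1 (s k).2.2).1 hk

/-! ## Soundness of the accelerated procedures for interpreted lemma symbols -/

section Uninterpreted

variable {L : FirstOrder.Language.{u, v}} {V : Type y} [L.Structure V] {m : ℕ}
  [(lemmaLang m).Structure V]

variable (V) in
/-- The interpretation of the `k`-th predicate symbol `b`. -/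
def baseRel (k : ℕ) (a : Fin m → V) : Prop :=
  Structure.RelMap (L := lemmaLang m) (LemmaSymb.b k) a

variable (V) in
/-- The interpretation of the `k`-th predicate symbol `st`. -/
def stepRel (k : ℕ) (a a' : Fin m → V) : Prop :=
  Structure.RelMap (L := lemmaLang m) (LemmaSymb.st k) (Fin.append a a')

variable (V) in
/-- The interpretation of the `k`-th predicate symbol `c`. -/
def concRel (k : ℕ) (a : Fin m → V) : Prop :=
  Structure.RelMap (L := lemmaLang m) (LemmaSymb.c k) a

theorem realize_lift (φ : L.Formula (Fin m)) (ε : UConst m → V) (a : Fin m → V) :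
    (lift φ).Realize (Sum.elim ε a) ↔ φ.Realize a :=
  realize_embed _ _ _ _ _

theorem realize_weaken (φ : (ULang L m).Formula (Fin m)) (ε : UConst m → V) (a : Fin m → V) :
    (weaken φ).Realize (Sum.elim ε a) ↔ φ.Realize a := by
  rw [weaken, Formula.realize_relabel]
  rfl

theorem realize_atomB (k : ℕ) (ε : UConst m → V) (a : Fin m → V) :
    (atomB (L := L) k).Realize (Sum.elim ε a) ↔ baseRel V k a := by
  exact Formula.realize_rel.trans Iff.rfl

theorem realize_atomC (k : ℕ) (a : Fin m → V) :
    (atomC (L := L) k).Realize a ↔ concRel V k a := by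
  exact Formula.realize_rel.trans Iff.rfl

theorem realize_atomSt (k : ℕ) (ε : UConst m → V) (a : Fin m → V) :
    (atomSt (L := L) k).Realize (Sum.elim ε a) ↔ stepRel V k (fun z => ε (k, z)) a := by
  refine Formula.realize_rel.trans (iff_of_eq (congrArg _ (funext fun j => ?_)))
  refine Fin.addCases (fun z => ?_) (fun z => ?_) j
  · rw [Fin.append_left, Fin.append_left]
    rfl
  · rw [Fin.append_right, Fin.append_right]
    rfl

/-- The values `ε` of the constants, where the `k`-th set is changed to `a`. -/
def setConst (ε : UConst m → V) (k : ℕ) (a : Fin m → V) (e : UConst m) : V :=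
  if e.1 = k then a e.2 else ε e

omit [L.Structure V] [(lemmaLang m).Structure V] in
theorem elim_constToVar (ε : UConst m → V) (k : ℕ) (a : Fin m → V) (e : UConst m) :
    Sum.elim ε a (constToVar k e) = setConst ε k a e := by
  unfold constToVar setConst
  split_ifs <;> rfl

/-- Substituting `X` for `E` and evaluating at `a` amounts to reinterpreting the constants `E` as
`a`. -/
theorem realize_constr_close (k : ℕ) (Ψ : Constr L m) (ε : UConst m → V) (a : Fin m → V) :
    (Ψ.close k).Realize (Sum.elim ε a) ↔ Formula.Realize Ψ (setConst ε k a) := by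
  rw [Constr.close, Formula.realize_relabel]
  exact iff_of_eq (congrArg _ (funext (elim_constToVar ε k a)))

theorem realize_uform_close (k : ℕ) (φ : UForm L m) (ε : UConst m → V) (a : Fin m → V) :
    (φ.close k).Realize (Sum.elim ε a) ↔ Formula.Realize φ (Sum.elim (setConst ε k a) a) := by
  rw [UForm.close, Formula.realize_relabel]
  refine iff_of_eq (congrArg _ (funext ?_))
  rintro (e | z)
  · exact elim_constToVar ε k a e
  · rfl

/-- The values of the constants agree below index `n`. -/
def AgreeBelow (n : ℕ) (ε ε' : UConst m → V) : Prop :=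
  ∀ e : UConst m, e.1 < n → ε e = ε' e

variable {Loc : Type x}

/-- The configurations that a symbolic set represents, given the values of the constants. -/
def UDom.rawSem (d : UDom L m Loc) (ε : UConst m → V) : Set (Loc × (Fin m → V)) :=
  {s | (d s.1).Realize (Sum.elim ε s.2)}

variable (V) in
/-- The meaning of a symbolic set depends only on the constants below index `n`. -/
def UDom.FreshFrom (n : ℕ) (d : UDom L m Loc) : Prop :=
  ∀ ε ε' : UConst m → V, AgreeBelow n ε ε' → d.rawSem ε = d.rawSem ε'

variable (V) in
/-- The meaning of a constraint depends only on the constants below index `n`. -/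
def Constr.FreshFrom (n : ℕ) (Ψ : Constr L m) : Prop :=
  ∀ ε ε' : UConst m → V, AgreeBelow n ε ε' → (Formula.Realize Ψ ε ↔ Formula.Realize Ψ ε')


omit [L.Structure V] [(lemmaLang m).Structure V] in
theorem AgreeBelow.mono {n n' : ℕ} {ε ε' : UConst m → V} (h : AgreeBelow n' ε ε') (hn : n ≤ n') :
    AgreeBelow n ε ε' :=
  fun e he => h e (he.trans_le hn)

omit [L.Structure V] [(lemmaLang m).Structure V] in
theorem AgreeBelow.setConst {n : ℕ} {ε ε' : UConst m → V} (h : AgreeBelow n ε ε') (k : ℕ)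
    (a : Fin m → V) : AgreeBelow n (setConst ε k a) (setConst ε' k a) := fun e he => by
  unfold ReactiveGame.setConst
  split_ifs
  · rfl
  · exact h e he

omit [L.Structure V] [(lemmaLang m).Structure V] in
theorem agreeBelow_setConst (ε : UConst m → V) (k : ℕ) (a : Fin m → V) :
    AgreeBelow k (setConst ε k a) ε := fun _ he => if_neg he.ne

theorem UDom.FreshFrom.mono {n n' : ℕ} {d : UDom L m Loc} (h : d.FreshFrom V n) (hn : n ≤ n') :
    d.FreshFrom V n' :=
  fun ε ε' he => h ε ε' (he.mono hn)

theorem Constr.FreshFrom.mono {n n' : ℕ} {Ψ : Constr L m} (h : Ψ.FreshFrom V n) (hn : n ≤ n') :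
    Ψ.FreshFrom V n' :=
  fun ε ε' he => h ε ε' (he.mono hn)

theorem Constr.FreshFrom.top {n : ℕ} : Constr.FreshFrom V n (⊤ : Constr L m) := fun _ _ _ => by
  simp

theorem Constr.FreshFrom.inf {n : ℕ} {Ψ Ψ' : Constr L m} (h : Ψ.FreshFrom V n)
    (h' : Ψ'.FreshFrom V n) : Constr.FreshFrom V n (Ψ ⊓ Ψ') := fun ε ε' he => by
  rw [Formula.realize_inf, Formula.realize_inf, h ε ε' he, h' ε ε' he]

variable {I : Type w}

theorem rawSem_sup (d e : UDom L m Loc) (ε : UConst m → V) :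
    UDom.rawSem (fun l => d l ⊔ e l) ε = d.rawSem ε ∪ e.rawSem ε := by
  ext s
  exact Formula.realize_sup

theorem rawSem_inf (d e : UDom L m Loc) (ε : UConst m → V) :
    UDom.rawSem (fun l => d l ⊓ e l) ε = d.rawSem ε ∩ e.rawSem ε := by
  ext s
  exact Formula.realize_inf

theorem rawSem_not (d : UDom L m Loc) (ε : UConst m → V) :
    UDom.rawSem (fun l => (d l).not) ε = (d.rawSem ε)ᶜ := by
  ext s
  exact Formula.realize_not

theorem rawSem_lift_inv (G : ProgramGame L V I m Loc) (ε : UConst m → V) :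
    UDom.rawSem (fun l => lift (G.inv l)) ε = G.invSet := by
  ext s
  exact realize_lift _ _ _

theorem rawSem_ucpre [Finite I] (G : ProgramGame L V I m Loc) (p : Player) (d : UDom L m Loc)
    (ε : UConst m → V) : (ucpre G p d).rawSem ε = G.pre p (d.rawSem ε) := by
  ext s
  exact realize_cpreExt _ G p d ε s.1 s.2

theorem rawSem_extendEnd_some (d : UDom L m Loc) (φ : UForm L m) (ε : UConst m → V)
    (l : Loc) (a : Fin m → V) :
    (some l, a) ∈ (extendEnd d φ).rawSem ε ↔ (l, a) ∈ d.rawSem ε := Iff.rfl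

/-- The configurations at `l` that satisfy `φ`. -/
def atLoc (V : Type y) [L.Structure V] [(lemmaLang m).Structure V] (l : Loc)
    (φ : (ULang L m).Formula (Fin m)) : Set (Loc × (Fin m → V)) :=
  {s | s.1 = l ∧ φ.Realize s.2}

theorem rawSem_update_sup (d : UDom L m Loc) (l : Loc) (φ : (ULang L m).Formula (Fin m))
    (ε : UConst m → V) :
    UDom.rawSem (open Classical in Function.update d l (d l ⊔ weaken φ)) ε =
      d.rawSem ε ∪ atLoc V l φ := by
  classical
  ext ⟨l', a⟩
  by_cases h : l' = l
  · subst h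
    simp [UDom.rawSem, atLoc, realize_weaken]
  · simp [UDom.rawSem, atLoc, h]

theorem rawSem_update_inf_not (d : UDom L m Loc) (l : Loc) (φ : (ULang L m).Formula (Fin m))
    (ε : UConst m → V) :
    UDom.rawSem (open Classical in Function.update d l (d l ⊓ (weaken φ).not)) ε =
      d.rawSem ε \ atLoc V l φ := by
  classical
  ext ⟨l', a⟩
  by_cases h : l' = l
  · subst h
    simp [UDom.rawSem, atLoc, realize_weaken]
  · simp [UDom.rawSem, atLoc, h]

theorem atLoc_accFormula (G : ProgramGame L V I m Loc) (l : Loc) (k : ℕ) :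
    atLoc V l (accFormula G l k) =
      {s | s.1 = l ∧ concRel V k s.2 ∧ (l, s.2) ∈ G.invSet} := by
  ext s
  refine and_congr_right fun _ => ?_
  rw [accFormula, Formula.realize_inf, realize_atomC, LHom.realize_onFormula]
  rfl

theorem realize_accAConstr (G : ProgramGame L V I m Loc) (l : Loc) (d : UDom L m Loc) (k : ℕ)
    (Ψrec : Constr L m) (a : UDom L m (Option Loc)) (ε : UConst m → V) :
    Formula.Realize (accAConstr G l d k Ψrec a) ε ↔
      (∀ s : Fin m → V, (l, s) ∈ G.invSet → baseRel V k s → (l, s) ∈ d.rawSem ε) ∧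
      ∀ s : Fin m → V, (l, s) ∈ G.invSet → (l, s) ∉ d.rawSem ε → concRel V k s →
        Formula.Realize Ψrec (setConst ε k s) ∧ (some l, s) ∈ a.rawSem (setConst ε k s) := by
  simp only [accAConstr, Formula.realize_inf, Formula.realize_iAlls, Formula.realize_imp,
    Formula.realize_not, realize_lift, realize_atomB, realize_weaken, realize_atomC,
    realize_constr_close, realize_uform_close, and_imp]
  rfl

theorem realize_accBConstr (G : ProgramGame L V I m Loc) (l : Loc) (f : UDom L m Loc) (k : ℕ)
    (Ψrec : Constr L m) (a : UDom L m (Option Loc)) (ε : UConst m → V) :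
    Formula.Realize (accBConstr G l f k Ψrec a) ε ↔
      (∀ s : Fin m → V, (l, s) ∈ G.invSet → baseRel V k s → (l, s) ∉ f.rawSem ε) ∧
      ∀ s : Fin m → V, (l, s) ∈ G.invSet → (l, s) ∈ f.rawSem ε → concRel V k s →
        Formula.Realize Ψrec (setConst ε k s) ∧ (some l, s) ∈ a.rawSem (setConst ε k s) := by
  simp only [accBConstr, Formula.realize_inf, Formula.realize_iAlls, Formula.realize_imp,
    Formula.realize_not, realize_lift, realize_atomB, realize_weaken, realize_atomC,
    realize_constr_close, realize_uform_close, and_imp]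
  rfl

theorem realize_precise [Finite I] (G : ProgramGame L V I m Loc) (p : Player) (a : UDom L m Loc)
    (ε : UConst m → V) :
    Formula.Realize (Precise G p a) ε ↔ G.pre p (a.rawSem ε) ⊆ a.rawSem ε := by
  have := G.loc_finite
  simp only [Precise, Formula.realize_iInf, Formula.realize_iAlls, Formula.realize_imp]
  constructor
  · rintro h ⟨l, s⟩ hs
    exact h l s ((realize_cpreExt _ G p a ε l s).2 hs)
  · intro h l s hs
    exact h ((realize_cpreExt _ G p a ε l s).1 hs)

theorem AgreeBelow.forall_congr_of_fresh {n : ℕ} {Ψ : Constr L m} {a : UDom L m Loc}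
    {ε ε' : UConst m → V} (he : AgreeBelow n ε ε') (hΨ : Ψ.FreshFrom V n) (ha : a.FreshFrom V n)
    (k : ℕ) (s : Fin m → V) (t : Loc × (Fin m → V)) :
    (Formula.Realize Ψ (ReactiveGame.setConst ε k s) ∧ t ∈ a.rawSem (ReactiveGame.setConst ε k s)) ↔
    (Formula.Realize Ψ (ReactiveGame.setConst ε' k s) ∧
      t ∈ a.rawSem (ReactiveGame.setConst ε' k s)) := by
  rw [hΨ _ _ (he.setConst k s), ha _ _ (he.setConst k s)]

theorem freshFrom_accAConstr (G : ProgramGame L V I m Loc) (l : Loc) {d : UDom L m Loc} (k : ℕ)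
    {n : ℕ} {Ψrec : Constr L m} {a : UDom L m (Option Loc)} (hd : d.FreshFrom V n)
    (hΨ : Ψrec.FreshFrom V n) (ha : a.FreshFrom V n) :
    (accAConstr G l d k Ψrec a).FreshFrom V n := fun ε ε' he => by
  simp only [realize_accAConstr, hd ε ε' he, he.forall_congr_of_fresh hΨ ha]

theorem freshFrom_accBConstr (G : ProgramGame L V I m Loc) (l : Loc) {f : UDom L m Loc} (k : ℕ)
    {n : ℕ} {Ψrec : Constr L m} {a : UDom L m (Option Loc)} (hf : f.FreshFrom V n)
    (hΨ : Ψrec.FreshFrom V n) (ha : a.FreshFrom V n) :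
    (accBConstr G l f k Ψrec a).FreshFrom V n := fun ε ε' he => by
  simp only [realize_accBConstr, hf ε ε' he, he.forall_congr_of_fresh hΨ ha]

theorem freshFrom_precise [Finite I] (G : ProgramGame L V I m Loc) (p : Player)
    {a : UDom L m Loc} {n : ℕ} (ha : a.FreshFrom V n) : (Precise G p a).FreshFrom V n :=
  fun ε ε' he => by rw [realize_precise, realize_precise, ha ε ε' he]

theorem UDom.FreshFrom.extendEnd {d : UDom L m Loc} {φ : UForm L m} {n : ℕ} (hd : d.FreshFrom V n)
    (hφ : ∀ ε ε' : UConst m → V, AgreeBelow n ε ε' → ∀ a : Fin m → V,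
      φ.Realize (Sum.elim ε a) ↔ φ.Realize (Sum.elim ε' a)) :
    UDom.FreshFrom V n (extendEnd d φ) := fun ε ε' he => by
  ext ⟨_ | l, a⟩
  · exact hφ ε ε' he a
  · exact Set.ext_iff.1 (hd ε ε' he) (l, a)

theorem realize_atomSt_congr {k : ℕ} {ε ε' : UConst m → V} (he : AgreeBelow (k + 1) ε ε')
    (a : Fin m → V) :
    (atomSt (L := L) k).Realize (Sum.elim ε a) ↔ (atomSt (L := L) k).Realize (Sum.elim ε' a) := by
  rw [realize_atomSt, realize_atomSt]
  simp only [fun z => he (k, z) (Nat.lt_succ_self k)]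

end Uninterpreted

-- Specifications of the symbolic procedures and their inductive proofs

section Soundness

variable {L : FirstOrder.Language.{u, v}} {V : Type y} [L.Structure V] {m : ℕ}
  [(lemmaLang m).Structure V] {I : Type w} [Finite I] {Loc : Type x}

/-- The sets represented by the symbolic sets of a loop game with `st(E, X)` at the new location,
when the constants `E` are interpreted as `s`. -/
theorem mem_rawSem_extendEnd_atomSt (d : UDom L m Loc) (k : ℕ) (ε : UConst m → V)
    (s a : Fin m → V) :
    (none, a) ∈ (extendEnd d (atomSt k)).rawSem (setConst ε k s) ↔ stepRel V k s a := by
  refine (realize_atomSt k (setConst ε k s) a).trans (iff_of_eq ?_)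
  simp [setConst]

/-- The specification of `IterA`. -/
def IterASpec (V : Type y) [L.Structure V] [(lemmaLang m).Structure V] (G : ProgramGame L V I m Loc)
    (p : Player) (Ψ : Constr L m) (d : UDom L m Loc) (n : ℕ) (Ψ' : Constr L m) (d' : UDom L m Loc)
    (n' : ℕ) : Prop :=
  Ψ.FreshFrom V n → d.FreshFrom V n → n ≤ n' ∧ Ψ'.FreshFrom V n' ∧ d'.FreshFrom V n' ∧
    ∀ ε : UConst m → V, d.rawSem ε ⊆ d'.rawSem ε ∧ (Formula.Realize Ψ' ε →
      Formula.Realize Ψ ε ∧ d'.rawSem ε ∩ G.invSet ⊆ G.attr p (d.rawSem ε))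

/-- The specification of `AccA`. -/
def AccASpec (V : Type y) [L.Structure V] [(lemmaLang m).Structure V] (G : ProgramGame L V I m Loc)
    (p : Player) (l : Loc) (d : UDom L m Loc) (n : ℕ) (Ψ : Constr L m)
    (φ : (ULang L m).Formula (Fin m)) (n' : ℕ) : Prop :=
  d.FreshFrom V n → n ≤ n' ∧ Ψ.FreshFrom V n' ∧
    ∀ ε : UConst m → V, Formula.Realize Ψ ε → atLoc V l φ ⊆ G.attr p (d.rawSem ε)

-- The configurations added by acceleration already belong to the attractor, so attracting to the
-- enlarged set gains nothing.
omit [Finite I] in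
theorem iterASpec_accelerate {G : ProgramGame L V I m Loc} {p : Player} {Ψ Ψrec Ψ' : Constr L m}
    {d d' : UDom L m Loc} {n n₁ n' : ℕ} {l : Loc} {φ : (ULang L m).Formula (Fin m)}
    (h₁ : AccASpec V G p l d n Ψrec φ n₁)
    (h₂ : IterASpec V G p (Ψ ⊓ Ψrec)
      (open Classical in Function.update d l (d l ⊔ weaken φ)) n₁ Ψ' d' n') :
    IterASpec V G p Ψ d n Ψ' d' n' := by
  intro hΨ hd
  obtain ⟨hn, hf, hs⟩ := h₁ hd
  obtain ⟨hn', hf', hd', hs'⟩ := h₂ ((hΨ.mono hn).inf hf) fun ε ε' he => by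
    rw [rawSem_update_sup, rawSem_update_sup, hd ε ε' (he.mono hn)]
  refine ⟨hn.trans hn', hf', hd', fun ε => ?_⟩
  obtain ⟨hsub, hs'⟩ := hs' ε
  rw [rawSem_update_sup] at hsub hs'
  refine ⟨Set.subset_union_left.trans hsub, fun hΨ' => ?_⟩
  obtain ⟨hΨ'', hattr⟩ := hs' hΨ'
  rw [Formula.realize_inf] at hΨ''
  refine ⟨hΨ''.1, hattr.trans (G.attr_subset_attr p ?_)⟩
  rintro s ⟨h | h, hi⟩
  · exact G.subset_attr p ⟨h, hi⟩
  · exact hs ε hΨ''.2 h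

theorem iterASpec_iterate {G : ProgramGame L V I m Loc} {p : Player} {Ψ Ψ' : Constr L m}
    {d d' : UDom L m Loc} {n n' : ℕ}
    (h : IterASpec V G p Ψ (fun l => d l ⊔ ucpre G p d l) n Ψ' d' n') :
    IterASpec V G p Ψ d n Ψ' d' n' := by
  intro hΨ hd
  obtain ⟨hn', hf', hd', hs'⟩ := h hΨ fun ε ε' he => by
    rw [rawSem_sup, rawSem_sup, rawSem_ucpre, rawSem_ucpre, hd ε ε' he]
  refine ⟨hn', hf', hd', fun ε => ?_⟩
  obtain ⟨hsub, hs'⟩ := hs' ε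
  rw [rawSem_sup, rawSem_ucpre] at hsub hs'
  refine ⟨Set.subset_union_left.trans hsub, fun hΨ' => ?_⟩
  obtain ⟨hΨ'', hattr⟩ := hs' hΨ'
  refine ⟨hΨ'', hattr.trans (G.attr_subset_attr p ?_)⟩
  rintro s ⟨h | h, hi⟩
  · exact G.subset_attr p ⟨h, hi⟩
  · exact G.pre_attr_subset p (G.pre_mono_on p (G.subset_attr p) h)

-- `IsAccTriple.conc_subset` is applied to membership in the attractor. At a bad `s`, with `E`
-- interpreted as `s`, the constraint puts `s` into the loop-game attractor to `d` or to `st(s, ·)`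
-- at `l_End`. Were all `st` successors of `s` in the attractor, projecting the loop game would
-- place `s` there too; so some successor is bad again.
omit [Finite I] in
theorem accASpec_intro (hacc : ∀ k, IsAccTriple (baseRel (m := m) V k) (stepRel V k) (concRel V k))
    {G : ProgramGame L V I m Loc} {p : Player} {l : Loc} {d : UDom L m Loc} {n n' : ℕ}
    {Ψrec : Constr L m} {a : UDom L m (Option Loc)}
    (h : IterASpec V (G.loop l) p ⊤ (extendEnd d (atomSt n)) (n + 1) Ψrec a n') :
    AccASpec V G p l d n (accAConstr G l d n Ψrec a) (accFormula G l n) n' := by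
  intro hd
  obtain ⟨hn, hf, ha, hs⟩ := h Constr.FreshFrom.top
    ((hd.mono n.le_succ).extendEnd fun ε ε' he => realize_atomSt_congr he)
  have hn' : n ≤ n' := n.le_succ.trans hn
  refine ⟨hn', freshFrom_accAConstr G l n (hd.mono hn') hf ha, fun ε hε => ?_⟩
  rw [realize_accAConstr] at hε
  rw [atLoc_accFormula]
  rintro ⟨l', s⟩ ⟨rfl, hc, hinv⟩
  -- `step` may lead to assignments violating the invariant; with the implication these count as
  -- good.
  refine (hacc n).conc_subset (P := fun s => (l', s) ∈ G.invSet → (l', s) ∈ G.attr p (d.rawSem ε))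
    (fun s hP hcs => ?_) hc hinv
  obtain ⟨hsinv, hsattr⟩ := Classical.not_imp.1 hP
  have hsd : (l', s) ∉ d.rawSem ε := fun h => hsattr (G.subset_attr p ⟨h, hsinv⟩)
  refine ⟨fun hb => hsd (hε.1 s hsinv hb), ?_⟩
  by_contra hno
  push Not at hno
  obtain ⟨hΨ, has⟩ := hε.2 s hsinv hsd hcs
  refine hsattr (G.loop_attr_subset p (l := l') (D' := (extendEnd d (atomSt n)).rawSem
    (setConst ε n s)) ?_ (((hs (setConst ε n s)).2 hΨ).2 ⟨has, hsinv⟩))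
  rintro ⟨_ | l₁, b⟩ ⟨hb, hbinv⟩
  · exact hno b ((mem_rawSem_extendEnd_atomSt d n ε s b).1 hb) hbinv
  -- Freshness is used here: `d` does not depend on the `n`-th set of constants, so interpreting it
  -- as `s` leaves `d` unchanged.
  · rw [rawSem_extendEnd_some, hd _ _ (agreeBelow_setConst ε n s)] at hb
    exact G.subset_attr p ⟨hb, hbinv⟩

theorem iterA_sound (hacc : ∀ k, IsAccTriple (baseRel (m := m) V k) (stepRel V k) (concRel V k))
    {G : ProgramGame L V I m Loc} {p : Player} {Ψ Ψ' : Constr L m} {d d' : UDom L m Loc} {n n' : ℕ}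
    (h : IterA G p Ψ d n Ψ' d' n') : IterASpec V G p Ψ d n Ψ' d' n' := by
  refine IterA.rec
    (motive_1 := fun G p Ψ d n Ψ' d' n' _ => IterASpec V G p Ψ d n Ψ' d' n')
    (motive_2 := fun G p l d n Ψ φ n' _ => AccASpec V G p l d n Ψ φ n') ?_ ?_ ?_ ?_ h
  · intro Loc G p Ψ d n hΨ hd
    exact ⟨le_rfl, hΨ, hd, fun ε => ⟨subset_rfl, fun h => ⟨h, G.subset_attr p⟩⟩⟩
  · intros
    exact iterASpec_accelerate ‹_› ‹_›
  · intros
    exact iterASpec_iterate ‹_›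
  · intros
    exact accASpec_intro hacc ‹_›

theorem accA_sound (hacc : ∀ k, IsAccTriple (baseRel (m := m) V k) (stepRel V k) (concRel V k))
    {G : ProgramGame L V I m Loc} {p : Player} {l : Loc} {Ψ : Constr L m} {d : UDom L m Loc}
    {φ : (ULang L m).Formula (Fin m)} {n n' : ℕ}
    (h : AccA G p l d n Ψ φ n') : AccASpec V G p l d n Ψ φ n' := by
  cases h with
  | intro h => exact accASpec_intro hacc (iterA_sound hacc h)

/-- The region that `IterB` computes: the opponent of `p` can enforce that a configuration of `B`
outside of `f` is reached or that `B` is visited only finitely often. -/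
def ProgramGame.escapeRegion (G : ProgramGame L V I m Loc) (B : Set Loc) (p : Player)
    (f : Set (Loc × (Fin m → V))) : Set (Loc × (Fin m → V)) :=
  G.coBuchiRegion p.opp B ({s | s.1 ∈ B} \ f)

/-- The specification of `IterB`. -/
def IterBSpec (V : Type y) [L.Structure V] [(lemmaLang m).Structure V] (G : ProgramGame L V I m Loc)
    (B : Set Loc) (p : Player) (Ψ : Constr L m) (f w : UDom L m Loc) (n : ℕ) (Ψ' : Constr L m)
    (w' : UDom L m Loc) (n' : ℕ) : Prop :=
  Ψ.FreshFrom V n → f.FreshFrom V n → w.FreshFrom V n →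
    n ≤ n' ∧ Ψ'.FreshFrom V n' ∧ w'.FreshFrom V n' ∧
    ∀ ε : UConst m → V, Formula.Realize Ψ' ε → Formula.Realize Ψ ε ∧
      (w.rawSem ε ∩ G.invSet ⊆ G.escapeRegion B p (f.rawSem ε) →
        w'.rawSem ε ∩ G.invSet ⊆ G.escapeRegion B p (f.rawSem ε))

/-- The specification of `AccB`. -/
def AccBSpec (V : Type y) [L.Structure V] [(lemmaLang m).Structure V] (G : ProgramGame L V I m Loc)
    (B : Set Loc) (p : Player) (l : Loc) (f : UDom L m Loc) (n : ℕ) (Ψ : Constr L m)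
    (φ : (ULang L m).Formula (Fin m)) (n' : ℕ) : Prop :=
  f.FreshFrom V n → n ≤ n' ∧ Ψ.FreshFrom V n' ∧ (l ∈ B →
    ∀ ε : UConst m → V, Formula.Realize Ψ ε → atLoc V l φ ⊆ G.escapeRegion B p (f.rawSem ε))

-- Removing from `f` configurations from which the opponent can already escape enlarges only the
-- target, and only by parts of the region. Hence nested rounds of `IterB` can all be measured
-- against the initial `f`.
omit [(lemmaLang m).Structure V] [Finite I] in
theorem ProgramGame.escapeRegion_eq (G : ProgramGame L V I m Loc) {B : Set Loc} {p : Player}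
    {f f' : Set (Loc × (Fin m → V))} (h : f' ⊆ f)
    (h' : ∀ s ∈ G.invSet, s.1 ∈ B → s ∈ f → s ∉ f' → s ∈ G.escapeRegion B p f) :
    G.escapeRegion B p f' = G.escapeRegion B p f := by
  refine (G.coBuchiRegion_subset_coBuchiRegion _ ?_).antisymm
    (G.coBuchiRegion_subset_coBuchiRegion _ ?_)
  · rintro s ⟨⟨hB, hf'⟩, hi⟩
    by_cases hf : s ∈ f
    · exact h' s hi hB hf hf'
    · exact G.target_subset_coBuchiRegion _ ⟨⟨hB, hf⟩, hi⟩
  · rintro s ⟨⟨hB, hf⟩, hi⟩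
    exact G.target_subset_coBuchiRegion _ ⟨⟨hB, fun h'' => hf (h h'')⟩, hi⟩

/-- The common part of both rounds of `IterB`. `IterA` may stop before its attractor is complete,
and being outside such an `a` would not let the opponent avoid `f`. The constraint `Precise` repairs
this by closing `a` under `pre p`. -/
theorem iterBSpec_attractors {G : ProgramGame L V I m Loc} (B : Set Loc) {p : Player}
    {Ψ Ψ₁ Ψ₂ : Constr L m} {f a w₁ f₁ : UDom L m Loc} {n n₁ n₂ : ℕ}
    (ha : IterASpec V G p Ψ f n Ψ₁ a n₁)
    (hw : IterASpec V G p.opp Ψ (fun l => lift (G.inv l) ⊓ (ucpre G p a l).not) n₁ Ψ₂ w₁ n₂)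
    (hf₁ : f₁ = fun l => f l ⊓ (lift (G.inv l) ⊓ (w₁ l).not))
    (hΨ : Ψ.FreshFrom V n) (hf : f.FreshFrom V n) :
    n ≤ n₂ ∧ (Ψ ⊓ (Ψ₁ ⊓ Precise G p a) ⊓ Ψ₂).FreshFrom V n₂ ∧ w₁.FreshFrom V n₂ ∧
      f₁.FreshFrom V n₂ ∧ ∀ ε : UConst m → V,
        Formula.Realize (Ψ ⊓ (Ψ₁ ⊓ Precise G p a) ⊓ Ψ₂) ε → Formula.Realize Ψ ε ∧
        w₁.rawSem ε ∩ G.invSet ⊆ G.escapeRegion B p (f.rawSem ε) ∧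
        G.escapeRegion B p (f₁.rawSem ε) = G.escapeRegion B p (f.rawSem ε) := by
  obtain ⟨hn₁, hΨ₁, haf, hs₁⟩ := ha hΨ hf
  obtain ⟨hn₂, hΨ₂, hwf, hs₂⟩ := hw (hΨ.mono hn₁) fun ε ε' he => by
    rw [rawSem_inf, rawSem_inf, rawSem_lift_inv, rawSem_lift_inv, rawSem_not, rawSem_not,
      rawSem_ucpre, rawSem_ucpre, haf ε ε' he]
  have hf₁s : ∀ ε : UConst m → V,
      f₁.rawSem ε = f.rawSem ε ∩ (G.invSet ∩ (w₁.rawSem ε)ᶜ) := fun ε => by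
    rw [hf₁, rawSem_inf, rawSem_inf, rawSem_lift_inv, rawSem_not]
  refine ⟨hn₁.trans hn₂, ((hΨ.mono (hn₁.trans hn₂)).inf ((hΨ₁.mono hn₂).inf
    ((freshFrom_precise G p haf).mono hn₂))).inf hΨ₂, hwf, fun ε ε' he => ?_, fun ε hε => ?_⟩
  · rw [hf₁s, hf₁s, hf ε ε' (he.mono (hn₁.trans hn₂)), hwf ε ε' he]
  · simp only [Formula.realize_inf, realize_precise] at hε
    obtain ⟨⟨hΨε, hΨ₁ε, hprec⟩, hΨ₂ε⟩ := hε
    have hsub := ((hs₂ ε).2 hΨ₂ε).2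
    rw [rawSem_inf, rawSem_lift_inv, rawSem_not, rawSem_ucpre] at hsub
    have hw₁ : w₁.rawSem ε ∩ G.invSet ⊆ G.escapeRegion B p (f.rawSem ε) :=
      (hsub.trans (G.attr_mono _ fun _ h => h.1.2)).trans
        (G.attr_opp_subset_coBuchiRegion p (hs₁ ε).1 hprec fun s hi hB hfs =>
          G.target_subset_coBuchiRegion _ ⟨⟨hB, hfs⟩, hi⟩)
    refine ⟨hΨε, hw₁, G.escapeRegion_eq ?_ fun s hi hB hfs hfs' => ?_⟩
    · rw [hf₁s]
      exact Set.inter_subset_left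
    · rw [hf₁s] at hfs'
      by_contra hs
      exact hfs' ⟨hfs, hi, fun h => hs (hw₁ ⟨h, hi⟩)⟩

theorem iterBSpec_iterate {G : ProgramGame L V I m Loc} {B : Set Loc} {p : Player}
    {Ψ Ψ₁ Ψ₂ Ψ' : Constr L m} {f a w w₁ f₁ w' : UDom L m Loc} {n n₁ n₂ n' : ℕ}
    (ha : IterASpec V G p Ψ f n Ψ₁ a n₁)
    (hw : IterASpec V G p.opp Ψ (fun l => lift (G.inv l) ⊓ (ucpre G p a l).not) n₁ Ψ₂ w₁ n₂)
    (hf₁ : f₁ = fun l => f l ⊓ (lift (G.inv l) ⊓ (w₁ l).not))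
    (h : IterBSpec V G B p (Ψ ⊓ (Ψ₁ ⊓ Precise G p a) ⊓ Ψ₂) f₁ w₁ n₂ Ψ' w' n') :
    IterBSpec V G B p Ψ f w n Ψ' w' n' := by
  intro hΨ hf _
  obtain ⟨hn, hΨ₂, hwf, hff, hs⟩ := iterBSpec_attractors B ha hw hf₁ hΨ hf
  obtain ⟨hn', hΨ', hwf', hs'⟩ := h hΨ₂ hff hwf
  refine ⟨hn.trans hn', hΨ', hwf', fun ε hε => ?_⟩
  obtain ⟨hε₂, hw'⟩ := hs' ε hε
  obtain ⟨hΨε, hw₁, heq⟩ := hs ε hε₂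
  rw [heq] at hw'
  exact ⟨hΨε, fun _ => hw' hw₁⟩

theorem iterBSpec_accelerate {G : ProgramGame L V I m Loc} {B : Set Loc} {p : Player}
    {Ψ Ψ₁ Ψ₂ Ψ₃ Ψ' : Constr L m} {f a w w₁ f₁ w' : UDom L m Loc} {n n₁ n₂ n₃ n' : ℕ} {l : Loc}
    {φ : (ULang L m).Formula (Fin m)}
    (ha : IterASpec V G p Ψ f n Ψ₁ a n₁)
    (hw : IterASpec V G p.opp Ψ (fun l => lift (G.inv l) ⊓ (ucpre G p a l).not) n₁ Ψ₂ w₁ n₂)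
    (hf₁ : f₁ = fun l => f l ⊓ (lift (G.inv l) ⊓ (w₁ l).not)) (hl : l ∈ B)
    (hacc : AccBSpec V G B p l f₁ n₂ Ψ₃ φ n₃)
    (h : IterBSpec V G B p (Ψ ⊓ (Ψ₁ ⊓ Precise G p a) ⊓ Ψ₂ ⊓ Ψ₃)
      (open Classical in Function.update f₁ l (f₁ l ⊓ (weaken φ).not))
      (open Classical in Function.update w₁ l (w₁ l ⊔ weaken φ)) n₃ Ψ' w' n') :
    IterBSpec V G B p Ψ f w n Ψ' w' n' := by
  intro hΨ hf _
  obtain ⟨hn, hΨ₂, hwf, hff, hs⟩ := iterBSpec_attractors B ha hw hf₁ hΨ hf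
  obtain ⟨hn₃, hΨ₃, hs₃⟩ := hacc hff
  obtain ⟨hn', hΨ', hwf', hs'⟩ := h ((hΨ₂.mono hn₃).inf hΨ₃)
    (fun ε ε' he => by
      rw [rawSem_update_inf_not, rawSem_update_inf_not, hff ε ε' (he.mono hn₃)])
    (fun ε ε' he => by
      rw [rawSem_update_sup, rawSem_update_sup, hwf ε ε' (he.mono hn₃)])
  refine ⟨(hn.trans hn₃).trans hn', hΨ', hwf', fun ε hε => ?_⟩
  obtain ⟨hε₂, hw'⟩ := hs' ε hε
  rw [Formula.realize_inf] at hε₂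
  obtain ⟨hΨε, hw₁, heq⟩ := hs ε hε₂.1
  have hφ := hs₃ hl ε hε₂.2
  have heq' : G.escapeRegion B p (f₁.rawSem ε \ atLoc V l φ) =
      G.escapeRegion B p (f₁.rawSem ε) :=
    G.escapeRegion_eq Set.sdiff_subset fun s _ _ hfs hfs' => by
      by_contra hs
      exact hfs' ⟨hfs, fun h => hs (hφ h)⟩
  rw [heq] at hφ
  rw [rawSem_update_sup, rawSem_update_inf_not, heq', heq] at hw'
  refine ⟨hΨε, fun _ => hw' ?_⟩
  rintro s ⟨h | h, hi⟩
  · exact hw₁ ⟨h, hi⟩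
  · exact hφ h

-- The argument for `AccA` with the escape region instead of the attractor. In the loop game,
-- leaving the set at `l_End` means satisfying `st`. Because `l` is accepting, a configuration at
-- `l` outside `f` is already a target, so a bad one lies in `f` and the constraint applies to it.
omit [Finite I] in
theorem accBSpec_intro (hacc : ∀ k, IsAccTriple (baseRel (m := m) V k) (stepRel V k) (concRel V k))
    {G : ProgramGame L V I m Loc} {B : Set Loc} {p : Player} {l : Loc} {f : UDom L m Loc}
    {n n' : ℕ} {Ψrec : Constr L m} {a : UDom L m (Option Loc)}
    (h : IterBSpec V (G.loop l) (insert none (some '' B)) p ⊤ (extendEnd f (atomSt n).not)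
      (fun _ => ⊥) (n + 1) Ψrec a n') :
    AccBSpec V G B p l f n (accBConstr G l f n Ψrec a) (accFormula G l n) n' := by
  intro hf
  obtain ⟨hn, hΨf, ha, hs⟩ := h Constr.FreshFrom.top
    ((hf.mono n.le_succ).extendEnd fun ε ε' he b => by
      rw [Formula.realize_not, Formula.realize_not, realize_atomSt_congr he])
    (fun _ _ _ => rfl)
  have hn' : n ≤ n' := n.le_succ.trans hn
  refine ⟨hn', freshFrom_accBConstr G l n (hf.mono hn') hΨf ha, fun hl ε hε => ?_⟩
  rw [realize_accBConstr] at hε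
  rw [atLoc_accFormula]
  rintro ⟨l', s⟩ ⟨rfl, hc, hinv⟩
  refine (hacc n).conc_subset
    (P := fun s => (l', s) ∈ G.invSet → (l', s) ∈ G.escapeRegion B p (f.rawSem ε))
    (fun s hP hcs => ?_) hc hinv
  obtain ⟨hsinv, hsesc⟩ := Classical.not_imp.1 hP
  have hsf : (l', s) ∈ f.rawSem ε := by
    by_contra h
    exact hsesc (G.target_subset_coBuchiRegion _ ⟨⟨hl, h⟩, hsinv⟩)
  refine ⟨fun hb => hε.1 s hsinv hb hsf, ?_⟩
  by_contra hno
  push Not at hno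
  obtain ⟨hΨ, has⟩ := hε.2 s hsinv hsf hcs
  refine hsesc (G.loop_coBuchiRegion_subset p.opp (l := l') (T' := {s | s.1 ∈ _} \
    (extendEnd f (atomSt n).not).rawSem (setConst ε n s)) ?_
      (((hs (setConst ε n s)) hΨ).2 ?_ ⟨has, hsinv⟩))
  · rintro ⟨_ | l₁, b⟩ ⟨⟨hB, hb⟩, hbinv⟩
    · refine hno b ?_ hbinv
      by_contra hst
      refine hb ?_
      change Formula.Realize (atomSt n).not _
      rw [Formula.realize_not]
      exact fun h => hst ((mem_rawSem_extendEnd_atomSt f n ε s b).1 h)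
    · rw [rawSem_extendEnd_some, hf _ _ (agreeBelow_setConst ε n s)] at hb
      have hB : l₁ ∈ B := by simpa using hB
      exact G.target_subset_coBuchiRegion _ ⟨⟨hB, hb⟩, hbinv⟩
  -- The recursive call starts with `w = ⊥`, so its precondition on `w` is vacuous.
  · rintro s ⟨h, -⟩
    exact absurd h id

theorem accB_sound (hacc : ∀ k, IsAccTriple (baseRel (m := m) V k) (stepRel V k) (concRel V k))
    {G : ProgramGame L V I m Loc} {B : Set Loc} {p : Player} {l : Loc} {Ψ : Constr L m}
    {f : UDom L m Loc} {φ : (ULang L m).Formula (Fin m)} {n n' : ℕ}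
    (h : AccB G B p l f n Ψ φ n') : AccBSpec V G B p l f n Ψ φ n' := by
  refine AccB.rec
    (motive_1 := fun G B p Ψ f w n Ψ' w' n' _ => IterBSpec V G B p Ψ f w n Ψ' w' n')
    (motive_2 := fun G B p l f n Ψ φ n' _ => AccBSpec V G B p l f n Ψ φ n') ?_ ?_ ?_ ?_ h
  · intro Loc G B p Ψ f w n hΨ hf hw
    exact ⟨le_rfl, hΨ, hw, fun ε h => ⟨h, id⟩⟩
  · intro _ _ _ _ _ _ _ _ _ _ _ _ _ _ _ _ _ _ _ _ _ _ h₁ h₂ hf hl _ _ h₃ h₄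
    exact iterBSpec_accelerate (iterA_sound hacc h₁) (iterA_sound hacc h₂) hf hl h₃ h₄
  · intro _ _ _ _ _ _ _ _ _ _ _ _ _ _ _ _ _ _ h₁ h₂ hf _ h₃
    exact iterBSpec_iterate (iterA_sound hacc h₁) (iterA_sound hacc h₂) hf h₃
  · intro _ _ _ _ _ _ _ _ _ _ _ h
    exact accBSpec_intro hacc h

end Soundness

/-! ## Instantiated lemma symbols -/

section Instantiate

variable {L : FirstOrder.Language.{u, v}} {V : Type y} [L.Structure V] {m : ℕ}

/-- The interpretation of the lemma symbols by the symbol's name. -/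
def lemmaSymbRel (lam : ℕ → AccLemma L V m) : {r : ℕ} → LemmaSymb m r → (Fin r → V) → Prop
  | _, .b k, ts => (lam k).base.Realize ts
  | _, .st k, ts => (lam k).step.Realize
      (Sum.elim (fun z => ts (Fin.castAdd m z)) (fun z => ts (Fin.natAdd m z)))
  | _, .c k, ts => (lam k).conc.Realize ts

/-- The interpretation of the lemma symbols by acceleration lemmas. -/
abbrev lemmaStructure (lam : ℕ → AccLemma L V m) : (lemmaLang m).Structure V where
  funMap f := Empty.elim f
  RelMap R := lemmaSymbRel lam R

theorem isAccTriple_lemmaStructure (lam : ℕ → AccLemma L V m) (k : ℕ) :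
    letI := lemmaStructure lam
    IsAccTriple (baseRel (m := m) V k) (stepRel V k) (concRel V k) := by
  let _ := lemmaStructure lam
  have hstep : ∀ a a' : Fin m → V, stepRel V k a a' → (lam k).step.Realize (Sum.elim a a') := by
    intro a a' h
    have h : (lam k).step.Realize (Sum.elim (fun z => Fin.append a a' (Fin.castAdd m z))
      (fun z => Fin.append a a' (Fin.natAdd m z))) := h
    simpa only [Fin.append_left, Fin.append_right] using h
  exact ⟨fun s hc hs => (lam k).reaches s hc fun i => hstep _ _ (hs i),
    fun a hc hb a' hs => (lam k).preserves a hc hb a' (hstep _ _ hs)⟩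

theorem realize_instTerm [(lemmaLang m).Structure V] {α : Type*} (t : (ULang L m).Term α)
    (e : α → V) : (instTerm t).realize e = t.realize e := by
  induction t with
  | var a => rfl
  | func f ts ih =>
    rcases f with f | f
    · simp only [instTerm, Term.realize, ih]
      rfl
    · exact f.elim

theorem realize_relabel_id_subst {α : Type*} {n : ℕ} {β : Type} (φ : L.Formula β)
    (ts : β → L.Term (α ⊕ Fin n)) (e : α → V) (xs : Fin n → V) :
    (BoundedFormula.relabel (k := 0) id (φ.subst ts) : L.BoundedFormula α (n + 0)).Realize e xs ↔
      φ.Realize fun z => (ts z).realize (Sum.elim e xs) := by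
  rw [BoundedFormula.realize_relabel, BoundedFormula.realize_subst, Formula.Realize]
  exact iff_of_eq (congrArg _ (Subsingleton.elim _ _))

/-- The substitution lemma: replacing lemma atoms by formulas has the same meaning as interpreting
the symbols by those formulas. -/
theorem realize_instLemma (lam : ℕ → AccLemma L V m) {α : Type*} {n : ℕ}
    (φ : (ULang L m).BoundedFormula α n) (e : α → V) (xs : Fin n → V) :
    letI := lemmaStructure lam
    (instLemma lam φ).Realize e xs ↔ φ.Realize e xs := by
  let _ := lemmaStructure lam
  induction φ with
  | falsum => rfl
  | equal t₁ t₂ =>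
    simp only [instLemma, BoundedFormula.Realize, realize_instTerm]
  | rel R ts =>
    rcases R with R | R
    · simp only [instLemma, BoundedFormula.Realize, realize_instTerm]
      rfl
    · rcases R with k | k | k
      · refine (realize_relabel_id_subst _ _ e xs).trans ?_
        simp only [realize_instTerm]
        rfl
      · refine (realize_relabel_id_subst _ _ e xs).trans
          (iff_of_eq (congrArg (lam k).step.Realize (funext ?_)))
        rintro (z | z) <;> exact realize_instTerm _ _
      · refine (realize_relabel_id_subst _ _ e xs).trans ?_
        simp only [realize_instTerm]
        rfl
  | imp φ ψ ih₁ ih₂ =>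
    simp only [instLemma, BoundedFormula.Realize, ih₁, ih₂]
  | all φ ih =>
    simp only [instLemma, BoundedFormula.Realize, ih]

end Instantiate

/-! ## The top-level procedures -/

section TopLevel

variable {L : FirstOrder.Language.{u, v}} {V : Type y} [L.Structure V] {m : ℕ}
  {I : Type w} {Loc : Type x}

theorem Dom.Equiv.rawSem_inter_subset {G : ProgramGame L V I m Loc} {d₁ d₂ : Dom L m Loc}
    (h : d₁.Equiv G d₂) : d₁.rawSem V ∩ G.invSet ⊆ d₂.rawSem V := fun s hs =>
  (Set.ext_iff.1 h ⟨s, hs.2⟩).1 hs.1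

theorem rawSem_update_sup' (d : Dom L m Loc) (l : Loc) (χ : L.Formula (Fin m)) :
    Dom.rawSem V (open Classical in Function.update d l (d l ⊔ χ)) =
      d.rawSem V ∪ {s | s.1 = l ∧ χ.Realize s.2} := by
  classical
  ext ⟨l', a⟩
  by_cases h : l' = l
  · subst h
    simp [Dom.rawSem]
  · simp [Dom.rawSem, h]

/-- What an instantiated formula represents lies in `R`, if it does so for all interpretations of
the lemma symbols by acceleration lemmas that satisfy the constraint. -/
theorem InstantiateLemmas.subset {G : ProgramGame L V I m Loc} {Ψ : Constr L m}
    {φ : (ULang L m).Formula (Fin m)} {χ : L.Formula (Fin m)} (h : InstantiateLemmas V Ψ φ χ)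
    (l : Loc) {R : Set (Loc × (Fin m → V))}
    (hR : ∀ [(lemmaLang m).Structure V],
      (∀ k, IsAccTriple (baseRel (m := m) V k) (stepRel V k) (concRel V k)) →
      ∀ ε : UConst m → V, Formula.Realize Ψ ε → atLoc V l φ ⊆ R) :
    {s : Loc × (Fin m → V) | s.1 = l ∧ χ.Realize s.2} ∩ G.invSet ⊆ R := by
  rintro ⟨l', a⟩ ⟨⟨hl, hχ⟩, -⟩
  rcases h with ⟨lam, hlam, rfl⟩ | rfl
  · let _ := lemmaStructure lam
    -- Validity covers all values of the constants, but one valuation must be exhibited, and `V`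
    -- might be empty; `a` provides the values.
    exact hR (isAccTriple_lemmaStructure lam) (fun e => a e.2)
      ((realize_instLemma lam Ψ _ _).1 (hlam _)) ⟨hl, (realize_instLemma lam φ _ _).1 hχ⟩
  · exact absurd hχ (by simp)

/-- Without input-enabledness the environment could force the empty set by a blocking input. -/
theorem ProgramGame.InputEnabled.pre_empty {G : ProgramGame L V I m Loc} (hG : G.InputEnabled)
    (p : Player) : G.pre p ∅ = ∅ := by
  refine Set.eq_empty_of_forall_notMem fun s hs => ?_
  have hi := G.pre_subset_invSet p hs
  cases p
  · obtain ⟨-, i, h⟩ := hs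
    obtain ⟨t, ht, hsrc, hg, hinv⟩ := hG s.1 s.2 hi i
    exact h t ⟨ht, hsrc, hg, hinv⟩
  · obtain ⟨t, -, -, i, -⟩ := G.no_dead_end s.1 s.2 hi
    obtain ⟨t, -, h⟩ := hs.2 i
    exact h

variable [Finite I] {G : ProgramGame L V I m Loc} {p : Player}

theorem AttractorAccelStep.sound {a a' : Dom L m Loc} (h : AttractorAccelStep G p a a') :
    a.rawSem V ⊆ a'.rawSem V ∧ a'.rawSem V ∩ G.invSet ⊆ G.attr p (a.rawSem V) := by
  rcases h with rfl | ⟨l, Ψ, φ, n, χ, hacc, hinst, rfl⟩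
  · exact ⟨subset_rfl, G.subset_attr p⟩
  · rw [rawSem_update_sup', Set.union_inter_distrib_right]
    refine ⟨Set.subset_union_left, Set.union_subset (G.subset_attr p)
      (hinst.subset l fun h ε hε => ?_)⟩
    have hlift : ∀ ε : UConst m → V,
        UDom.rawSem (fun l' => lift (a l')) ε = a.rawSem V := fun ε => by
      ext s
      exact realize_lift _ _ _
    rw [← hlift ε]
    refine (accA_sound h hacc fun ε ε' _ => ?_).2.2 ε hε
    rw [hlift, hlift]

/-- The loop invariant is that each iterate contains the predecessors of the one before. When two
consecutive iterates agree on the states, the result is therefore closed under `pre`. -/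
theorem AttractorLoop.sound {a₀ a r : Dom L m Loc} (h : AttractorLoop G p a₀ a r)
    (ha : G.pre p (a₀.rawSem V) ⊆ a.rawSem V) :
    a.rawSem V ⊆ r.rawSem V ∧ r.rawSem V ∩ G.invSet ⊆ G.attr p (a.rawSem V) ∧
      G.pre p (r.rawSem V) ⊆ r.rawSem V := by
  induction h with
  | done h => exact ⟨subset_rfl, G.subset_attr p, (G.pre_mono_on p h.rawSem_inter_subset).trans ha⟩
  | @next a₀ a a' r _ hstep _ ih =>
    obtain ⟨hsub, hattr⟩ := hstep.sound
    have hsup : Dom.rawSem V (fun l => a' l ⊔ cpre G p a' l) =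
        a'.rawSem V ∪ G.pre p (a'.rawSem V) := by
      rw [← rawSem_cpre]
      ext s
      exact Formula.realize_sup
    rw [hsup] at ih
    obtain ⟨h₁, h₂, h₃⟩ := ih Set.subset_union_right
    refine ⟨hsub.trans (Set.subset_union_left.trans h₁), h₂.trans (G.attr_subset_attr p ?_), h₃⟩
    rintro s ⟨hs | hs, hi⟩
    · exact hattr ⟨hs, hi⟩
    · exact G.pre_attr_subset p (G.pre_mono_on p hattr hs)

theorem AttractorAcc.sound (hG : G.InputEnabled) {d r : Dom L m Loc} (h : AttractorAcc G p d r) :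
    d.rawSem V ⊆ r.rawSem V ∧ r.rawSem V ∩ G.invSet ⊆ G.attr p (d.rawSem V) ∧
      G.pre p (r.rawSem V) ⊆ r.rawSem V := by
  refine AttractorLoop.sound h ?_
  have : Dom.rawSem V (fun _ : Loc => (⊥ : L.Formula (Fin m))) = ∅ :=
    Set.eq_empty_of_forall_notMem fun s hs => hs
  rw [this, hG.pre_empty]
  exact Set.empty_subset _

omit [Finite I] in
/-- If player `p` can return to `f ⊆ B` from `f` again and again, the co-Büchi region of the
opponent contains no configuration from which `p` can enter the attractor to `f`. -/
theorem ProgramGame.coBuchiRegion_opp_subset {B : Set Loc} {f a w : Set (Loc × (Fin m → V))}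
    (hfB : ∀ s ∈ f, s ∈ G.invSet → s.1 ∈ B) (ha : a ∩ G.invSet ⊆ G.attr p f)
    (hw : ∀ s ∈ G.invSet, s ∉ G.pre p a → s ∈ w) (hfw : ∀ s ∈ f, s ∈ G.invSet → s ∉ w) :
    G.coBuchiRegion p.opp B ∅ ⊆ w := by
  have hpre : ∀ s ∈ G.invSet, s ∉ w → s ∈ G.pre p (G.attr p f) := fun s hi hs =>
    G.pre_mono_on p ha (by_contra fun h => hs (hw s hi h))
  have hcompl : ∀ {s R}, s ∈ G.pre p.opp Rᶜ → s ∉ G.pre p R := fun h =>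
    (G.mem_pre_opp_compl p (G.pre_subset_invSet _ h)).1 h
  have hK : G.coBuchiRegion p.opp B ∅ ⊆ (G.attr p f)ᶜ := by
    refine G.coBuchiRegion_subset _ fun X hX => ?_
    -- Induction along the attractor: on `f`, being in `B`, membership in `X` would need a move of
    -- the opponent out of the attractor, which `p` can prevent; further out, `p` can move to a
    -- configuration already shown to avoid `X`.
    have : G.attr p f ⊆ G.attr p f ∩ Xᶜ := by
      refine G.attr_subset p ?_ fun s hs => ?_
      · rintro s ⟨hs, hi⟩
        refine ⟨G.subset_attr p ⟨hs, hi⟩, fun hsX => ?_⟩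
        rcases hX s hsX with h | h | h
        · exact h.1
        · exact hcompl h (hpre s hi (hfw s hs hi))
        · exact h.1 (hfB s hs hi)
      · have hs' := G.pre_mono p Set.inter_subset_left hs
        refine ⟨G.pre_attr_subset p hs', fun hsX => ?_⟩
        rcases hX s hsX with h | h | h
        · exact h.1
        · exact hcompl h hs'
        · rw [← compl_compl X] at h
          exact hcompl h.2 (G.pre_mono p Set.inter_subset_right hs)
    exact fun s hs hs' => (this hs').2 hs
  intro s hs
  by_contra hsw
  exact hK hs (G.pre_attr_subset p (hpre s (G.coBuchiRegion_subset_invSet _ hs) hsw))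

/-- Accepting configurations outside `f \ w` already lie in the region with empty target, so the
escape region that `accB_sound` provides is contained in it. -/
theorem BuchiAccelStep.sound {B : Set Loc} {f w w' : Dom L m Loc}
    (h : BuchiAccelStep G B p f w w')
    (hf : ∀ s ∈ G.invSet, s.1 ∈ B → s ∉ f.rawSem V → s ∈ G.coBuchiRegion p.opp B ∅)
    (hw : w.rawSem V ∩ G.invSet ⊆ G.coBuchiRegion p.opp B ∅) :
    w.rawSem V ⊆ w'.rawSem V ∧ w'.rawSem V ∩ G.invSet ⊆ G.coBuchiRegion p.opp B ∅ := by
  rcases h with rfl | ⟨l, hl, Ψ, φ, n, χ, hacc, hinst, rfl⟩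
  · exact ⟨subset_rfl, hw⟩
  · rw [rawSem_update_sup', Set.union_inter_distrib_right]
    refine ⟨Set.subset_union_left, Set.union_subset hw (hinst.subset l fun h ε hε => ?_)⟩
    have hlift : ∀ ε : UConst m → V,
        UDom.rawSem (fun l' => lift (f l' ⊓ (G.inv l' ⊓ (w l').not))) ε =
          f.rawSem V ∩ (G.invSet ∩ (w.rawSem V)ᶜ) := fun ε => by
      ext s
      refine (realize_lift _ _ _).trans ?_
      rw [Formula.realize_inf, Formula.realize_inf, Formula.realize_not]
      rfl
    refine ((accB_sound h hacc fun ε ε' _ => ?_).2.2 hl ε hε).trans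
      (G.coBuchiRegion_subset_coBuchiRegion _ ?_)
    · rw [hlift, hlift]
    · rw [hlift]
      rintro s ⟨⟨hB, hs⟩, hi⟩
      by_contra hK
      exact hs ⟨by_contra fun hf' => hK (hf s hi hB hf'), hi, fun hw' => hK (hw ⟨hw', hi⟩)⟩

/-- The hypotheses are the loop invariants. `hdone` is conditional because completeness of `w` is
only known when the termination test succeeds: then `f` has lost no state to `w`. -/
theorem SolveBuchiLoop.sound (hG : G.InputEnabled) {B : Set Loc} {f₀ f w r : Dom L m Loc}
    (h : SolveBuchiLoop G B p f₀ f w r)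
    (hfB : ∀ s ∈ f.rawSem V, s ∈ G.invSet → s.1 ∈ B)
    (hf : ∀ s ∈ G.invSet, s.1 ∈ B → s ∉ f.rawSem V → s ∈ G.coBuchiRegion p.opp B ∅)
    (hw : w.rawSem V ∩ G.invSet ⊆ G.coBuchiRegion p.opp B ∅)
    (hdone : f.Equiv G f₀ → G.coBuchiRegion p.opp B ∅ ⊆ w.rawSem V) :
    r.rawSem V ∩ G.invSet = G.coBuchiRegion p.opp B ∅ := by
  induction h with
  | done h => exact hw.antisymm (Set.subset_inter (hdone h) (G.coBuchiRegion_subset_invSet _))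
  | @next f₀ f w₀ a w w' r _ ha hattr hacc _ ih =>
    obtain ⟨hfa, haf, hpre⟩ := ha.sound hG
    obtain ⟨hsub, hwsub, -⟩ := hattr.sound hG
    have hnot : Dom.rawSem V (fun l => (cpre G p a l).not) = (G.pre p (a.rawSem V))ᶜ := by
      rw [← rawSem_cpre]
      ext s
      exact Formula.realize_not
    rw [hnot] at hsub hwsub
    obtain ⟨hww', hw'⟩ := hacc.sound hf
      (hwsub.trans (G.attr_opp_subset_coBuchiRegion p hfa hpre hf))
    have hf₁ : Dom.rawSem V (fun l => f l ⊓ (G.inv l ⊓ (w' l).not)) =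
        f.rawSem V ∩ (G.invSet ∩ (w'.rawSem V)ᶜ) := by
      ext s
      refine Formula.realize_inf.trans (and_congr_right fun _ => Formula.realize_inf.trans
        (and_congr_right fun _ => Formula.realize_not))
    refine ih ?_ ?_ hw' fun heq => ?_
    · rw [hf₁]
      exact fun s hs => hfB s hs.1
    · rw [hf₁]
      intro s hi hB hs
      by_contra hK
      exact hs ⟨by_contra fun hf' => hK (hf s hi hB hf'), hi, fun h => hK (hw' ⟨h, hi⟩)⟩
    · refine G.coBuchiRegion_opp_subset hfB haf (fun s _ hs => hww' (hsub hs)) fun s hs hi => ?_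
      have := Dom.Equiv.rawSem_inter_subset (Eq.symm heq) ⟨hs, hi⟩
      rw [hf₁] at this
      exact this.2.2

theorem SolveBuchiAcc.sound (hG : G.InputEnabled) {B : Set Loc} {r : Dom L m Loc}
    (h : SolveBuchiAcc G B p (acceptingDom G B) r) :
    r.rawSem V ∩ G.invSet = G.coBuchiRegion p.opp B ∅ := by
  have hB : ∀ s, s ∈ (acceptingDom G B).rawSem V ↔ s.1 ∈ B ∧ s ∈ G.invSet := fun s => by
    by_cases h : s.1 ∈ B
    · simp [Dom.rawSem, acceptingDom, h, ProgramGame.invSet]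
    · simp [Dom.rawSem, acceptingDom, h]
  refine SolveBuchiLoop.sound hG h (fun s hs _ => ((hB s).1 hs).1)
    (fun s hi hs hs' => absurd ((hB s).2 ⟨hs, hi⟩) hs') (fun s hs => absurd hs.1 id) fun heq => ?_
  have huniv : ∀ s ∈ G.invSet, s ∈ (acceptingDom G B).rawSem V := fun s hi =>
    Dom.Equiv.rawSem_inter_subset (Eq.symm heq) ⟨fun h => h, hi⟩
  -- If the very first test succeeds, `⊥` is returned. All states are then accepting, and the region
  -- is empty by the completeness argument with trivial `a` and `w`.
  refine (G.coBuchiRegion_opp_subset (p := p) (f := (acceptingDom G B).rawSem V)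
    (a := Set.univ) (w := ∅) (fun s hs _ => ((hB s).1 hs).1) ?_ ?_ fun _ _ _ h => h).trans
    (Set.empty_subset _)
  · exact fun s hs => G.subset_attr p ⟨huniv s hs.2, hs.2⟩
  · intro s hi hs
    rw [← G.mem_pre_opp_compl p hi, Set.compl_univ, hG.pre_empty] at hs
    exact hs

end TopLevel

/-! ## Winning strategies -/

/-- A pair of strategies has an outcome. -/
theorem GameStructure.exists_isOutcome {S Me Ms : Type*} (G : GameStructure S Me Ms) (s : S)
    (σe : G.EnvStrategy) (σs : G.SysStrategy) : ∃ π, G.IsOutcome s σe σs π := by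
  have hnext : ∀ c : List S × S, ∃ s', G.trans c.2 (σe.move c.1 c.2)
      (σs.move c.1 c.2 (σe.move c.1 c.2)) s' := fun c =>
    σs.enabled c.1 c.2 _ (σe.enabled c.1 c.2)
  choose next hnext using hnext
  let run : ℕ → List S × S := fun n => (fun c => (c.1 ++ [c.2], next c))^[n] ([], s)
  have hrun : ∀ n, run (n + 1) = ((run n).1 ++ [(run n).2], next (run n)) := fun n =>
    Function.iterate_succ_apply' _ _ _
  have hhist : ∀ n, (List.range n).map (fun i => (run i).2) = (run n).1 := fun n => by
    induction n with
    | zero => rfl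
    | succ n ih => rw [List.range_succ, List.map_append, ih, hrun, List.map_singleton]
  refine ⟨fun i => (run i).2, rfl, fun i => ?_⟩
  rw [hhist]
  change G.trans _ _ _ (run (i + 1)).2
  rw [hrun]
  exact hnext (run i)

theorem GameStructure.disjoint_winning {S Me Ms : Type*} (G : GameStructure S Me Ms) (p : Player)
    (Ω : Set (ℕ → S)) : Disjoint (G.winning p Ω) (G.winning p.opp Ωᶜ) := by
  refine Set.disjoint_left.2 fun s h h' => ?_
  cases p
  · obtain ⟨σe, he⟩ := h
    obtain ⟨σs, hs⟩ := h'
    obtain ⟨π, hπ⟩ := G.exists_isOutcome s σe σs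
    exact hs σe π hπ (he σs π hπ)
  · obtain ⟨σs, hs⟩ := h
    obtain ⟨σe, he⟩ := h'
    obtain ⟨π, hπ⟩ := G.exists_isOutcome s σe σs
    exact he σs π hπ (hs σe π hπ)

/-- The elements of a least fixed point can be ranked by ordinals. -/
theorem exists_rank_lfp {α : Type u} (Φ : Set α →o Set α) :
    ∃ (S : Ordinal.{u} → Set α) (ρ : α → Ordinal.{u}),
      (∀ s ∈ Φ.lfp, s ∈ Φ (S (ρ s))) ∧ (∀ b, Φ (S b) ⊆ Φ.lfp) ∧
      (∀ b, ∀ s ∈ Φ (S b), ρ s ≤ b) ∧ ∀ b, ∀ s ∈ S b, s ∈ Φ.lfp ∧ ρ s < b := by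
  -- The stage `S b` is the union of `Φ (S c)` over `c < b`, and the rank is the least `c` with `s ∈
  -- Φ (S c)`.
  let S := OrdinalApprox.lfpApprox Φ ⊥
  have hS : ∀ b, S b ⊆ Φ.lfp := fun b =>
    OrdinalApprox.lfpApprox_le_of_mem_fixedPoints Φ Φ.map_lfp bot_le b
  have hlt : ∀ b, ∀ s ∈ S b, ∃ c < b, s ∈ Φ (S c) := fun b s hs => by
    change s ∈ OrdinalApprox.lfpApprox Φ ⊥ b at hs
    rw [OrdinalApprox.lfpApprox] at hs
    simpa [S] using hs
  have hle : ∀ b, ∀ s ∈ Φ (S b), sInf {c | s ∈ Φ (S c)} ≤ b := fun b s hs =>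
    csInf_le' hs
  refine ⟨S, fun s => sInf {c | s ∈ Φ (S c)}, fun s hs => ?_, fun b => ?_, hle, fun b s hs => ?_⟩
  · rw [← OrdinalApprox.lfpApprox_ord_eq_lfp] at hs
    obtain ⟨c, -, hc⟩ := hlt _ s hs
    exact csInf_mem (s := {c | s ∈ Φ (S c)}) ⟨c, hc⟩
  · exact (Φ.mono (hS b)).trans Φ.map_lfp.le
  · obtain ⟨c, hcb, hc⟩ := hlt b s hs
    exact ⟨hS b hs, (hle c s hc).trans_lt hcb⟩

section Winning

variable {L : FirstOrder.Language.{u, v}} {V : Type y} [L.Structure V] {I : Type w} {m : ℕ}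
  {Loc : Type x} {G : ProgramGame L V I m Loc}

namespace ProgramGame

theorem sem_trans_iff {s s' : G.State} {i : I → V} {f : G.Updates} :
    G.sem.trans s i f s' ↔
      ∃ t, G.Permits s.1 i t ∧ t.update = f.1 ∧ s'.1 = (t.tgt, t.apply s.1.2 i) := by
  constructor
  · rintro ⟨t, ht, hs, hu, hl, hg, hv⟩
    have h : s'.1 = (t.tgt, t.apply s.1.2 i) := by
      refine Prod.ext hl.symm (hv.trans ?_)
      rw [← hu]
      rfl
    exact ⟨t, ⟨ht, hs, hg, h ▸ s'.2⟩, hu, h⟩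
  · rintro ⟨t, ⟨ht, hs, hg, -⟩, hu, h⟩
    refine ⟨t, ht, hs, hu, (congrArg Prod.fst h).symm, hg, (congrArg Prod.snd h).trans ?_⟩
    rw [← hu]
    rfl

theorem exists_trans_of_permits {s : G.State} {i : I → V} {t : Transition L I m Loc}
    (h : G.Permits s.1 i t) : ∃ f : G.Updates, ∃ s' : G.State, G.sem.trans s i f s' ∧
      s'.1 = (t.tgt, t.apply s.1.2 i) :=
  ⟨⟨t.update, t, h.1, rfl⟩, ⟨_, h.2.2.2⟩, sem_trans_iff.2 ⟨t, h, rfl, rfl⟩, rfl⟩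

/-- In an input-enabled game, a memoryless choice of controllable successor sets yields a
strategy. -/
theorem InputEnabled.mem_winning (hG : G.InputEnabled) (p : Player)
    (R : Loc × (Fin m → V) → Set (Loc × (Fin m → V))) {s : G.State} {Ω : Set (ℕ → G.State)}
    (h : ∀ π : ℕ → G.State, π 0 = s →
      (∀ n, (π n).1 ∈ G.pre p (R (π n).1) → (π (n + 1)).1 ∈ R (π n).1) → π ∈ Ω) :
    s ∈ G.sem.winning p Ω := by
  have hen : ∀ (s : G.State) (i : I → V), ∃ t, G.Permits s.1 i t := fun s i => by
    obtain ⟨t, ht, hs, hg, hi⟩ := hG s.1.1 s.1.2 s.2 i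
    exact ⟨t, ht, hs, hg, hi⟩
  cases p
  · have hmv : ∀ s : G.State, ∃ i : I → V, s.1 ∈ G.pre .env (R s.1) →
        ∀ t, G.Permits s.1 i t → (t.tgt, t.apply s.1.2 i) ∈ R s.1 := fun s => by
      by_cases hs : s.1 ∈ G.pre .env (R s.1)
      · obtain ⟨-, i, hi⟩ := id hs
        exact ⟨i, fun _ => hi⟩
      · obtain ⟨-, -, -, i, -⟩ := G.no_dead_end _ _ s.2
        exact ⟨i, fun h => absurd h hs⟩
    choose mv hmv using hmv
    refine ⟨⟨fun _ s => mv s, fun _ s => ?_⟩, fun σs π hπ => h π hπ.1 fun n hn => ?_⟩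
    · obtain ⟨t, ht⟩ := hen s (mv s)
      obtain ⟨f, s', hf, -⟩ := exists_trans_of_permits ht
      exact ⟨f, s', hf⟩
    · obtain ⟨t, ht, -, heq⟩ := sem_trans_iff.1 (hπ.2 n)
      rw [heq]
      exact hmv _ hn t ht
  · have hmv : ∀ (s : G.State) (i : I → V), ∃ f : G.Updates, f ∈ G.sem.enabledSys s i ∧
        (s.1 ∈ G.pre .sys (R s.1) → ∀ s', G.sem.trans s i f s' → s'.1 ∈ R s.1) := fun s i => by
      by_cases hs : s.1 ∈ G.pre .sys (R s.1)
      · obtain ⟨t, ht, hR⟩ := hs.2 i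
        obtain ⟨f, s', hf, heq⟩ := exists_trans_of_permits ht
        refine ⟨f, ⟨s', hf⟩, fun _ s'' hs'' => ?_⟩
        rw [G.sem.succ_unique _ _ _ _ _ hs'' hf, heq]
        exact hR
      · obtain ⟨t, ht⟩ := hen s i
        obtain ⟨f, s', hf, -⟩ := exists_trans_of_permits ht
        exact ⟨f, ⟨s', hf⟩, fun h => absurd h hs⟩
    choose mv hmv using hmv
    exact ⟨⟨fun _ s i => mv s i, fun _ s i _ => (hmv s i).1⟩,
      fun σe π hπ => h π hπ.1 fun n hn => (hmv _ _).2 hn _ (hπ.2 n)⟩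

/-- Rank by the outer fixed point. The strategy enters a smaller stage if it can and otherwise stays
in the greatest fixed point of the current stage, which is only necessary outside `B`. Ranks never
increase and drop at each visit to `B`; being ordinals, they become constant. -/
theorem InputEnabled.mem_winning_coBuchi (hG : G.InputEnabled) (p : Player) (B : Set Loc)
    {s : G.State} (hs : s.1 ∈ G.coBuchiRegion p B ∅) : s ∈ G.sem.winning p (G.coBuchi B) := by
  classical
  obtain ⟨S, ρ, hρ, hsub, hle, hlt⟩ := exists_rank_lfp (G.coBuchiOuter p B ∅)
  refine hG.mem_winning p (fun s => if s ∈ G.pre p (S (ρ s)) then S (ρ s)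
    else G.coBuchiOuter p B ∅ (S (ρ s))) fun π hπ hstep => ?_
  have key : ∀ n, (π n).1 ∈ G.coBuchiRegion p B ∅ → (π (n + 1)).1 ∈ G.coBuchiRegion p B ∅ ∧
      ρ (π (n + 1)).1 ≤ ρ (π n).1 ∧ ((π n).loc ∈ B → ρ (π (n + 1)).1 < ρ (π n).1) := by
    intro n hn
    have hn' : (π n).1 ∈ (G.coBuchiInner p B ∅ (S (ρ (π n).1))).gfp := hρ _ hn
    rw [← (G.coBuchiInner p B ∅ (S (ρ (π n).1))).map_gfp] at hn'
    have := hstep n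
    by_cases hpre : (π n).1 ∈ G.pre p (S (ρ (π n).1))
    · rw [if_pos hpre] at this
      obtain ⟨h₁, h₂⟩ := hlt _ _ (this hpre)
      exact ⟨h₁, h₂.le, fun _ => h₂⟩
    · rw [if_neg hpre] at this
      rcases hn' with (h | h) | h
      · exact absurd h.1 id
      · exact absurd h hpre
      · exact ⟨hsub _ (this h.2), hle _ _ (this h.2), fun hB => absurd hB h.1⟩
  have hmem : ∀ n, (π n).1 ∈ G.coBuchiRegion p B ∅ := fun n => by
    induction n with
    | zero => rwa [hπ]
    | succ n ih => exact (key n ih).1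
  have hanti : Antitone fun n => ρ (π n).1 := antitone_nat_of_succ_le fun n => (key n (hmem n)).2.1
  obtain ⟨k, hk⟩ := WellFoundedLT.antitone_chain_condition hanti
  exact ⟨k, fun n hn hB => ((key n (hmem n)).2.2 hB).ne
    ((hk (n + 1) (hn.trans n.le_succ)).symm.trans (hk n hn))⟩

/-- From the complement `Z` of the region, the opponent can force a visit to `B` and remain in `Z`:
this is the least fixed point of `Φ`, and configurations outside it are in the region by
coinduction. The strategy lowers the rank off `B` and only stays in `Z` on `B`, so avoiding `B` from
some point on would give an infinite descent of ordinals. -/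
theorem InputEnabled.mem_winning_compl_coBuchi (hG : G.InputEnabled) (p : Player) (B : Set Loc)
    {s : G.State} (hs : s.1 ∉ G.coBuchiRegion p B ∅) :
    s ∈ G.sem.winning p.opp (G.coBuchi B)ᶜ := by
  classical
  let Z : Set (Loc × (Fin m → V)) := (G.coBuchiRegion p B ∅)ᶜ
  have hZ : G.pre p.opp Z ⊆ Z := fun s h hK => by
    rcases G.mem_coBuchiRegion_cases p hK with h' | h'
    · exact h'.1
    · exact (G.mem_pre_opp_compl p (G.pre_subset_invSet _ h)).1 h h'
  let Φ : Set (Loc × (Fin m → V)) →o Set (Loc × (Fin m → V)) :=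
    ⟨fun X => G.pre p.opp Z ∩ ({s | s.1 ∈ B} ∪ G.pre p.opp X), fun _ _ h =>
      Set.inter_subset_inter_right _ (Set.union_subset_union_right _ (G.pre_mono _ h))⟩
  have hΦ : Φ.lfp = G.pre p.opp Z ∩ ({s | s.1 ∈ B} ∪ G.pre p.opp Φ.lfp) := Φ.map_lfp.symm
  have hZΦ : ∀ s ∈ G.invSet, s ∈ Z → s ∈ Φ.lfp := by
    have : G.invSet ∩ Φ.lfpᶜ ⊆ G.coBuchiRegion p B ∅ := by
      refine G.subset_coBuchiRegion_of_step p fun s hs => ?_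
      have hs' := hs.2
      rw [hΦ, Set.mem_compl_iff, Set.mem_inter_iff, not_and_or, G.mem_pre_opp_compl p hs.1,
        not_not, Set.mem_union, not_or, ← compl_compl Φ.lfp, G.mem_pre_opp_compl p hs.1,
        not_not] at hs'
      rcases hs' with h | ⟨hB, h⟩
      · exact Or.inl (G.pre_coBuchiRegion_subset p h)
      · exact Or.inr ⟨hB, G.pre_mono_on p (fun s hs => Or.inl ⟨hs.2, hs.1⟩) h⟩
    exact fun s hi hs => by_contra fun h => hs (this ⟨hi, h⟩)
  obtain ⟨S, ρ, hρ, -, -, hlt⟩ := exists_rank_lfp Φ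
  refine hG.mem_winning p.opp (fun s => if s.1 ∈ B then Z else S (ρ s)) fun π hπ hstep => ?_
  have key : ∀ n, (π n).1 ∈ Z → (π (n + 1)).1 ∈ Z ∧
      ((π n).loc ∉ B → ρ (π (n + 1)).1 < ρ (π n).1) := by
    intro n hn
    have hn' := hρ _ (hZΦ _ (π n).2 hn)
    have := hstep n
    by_cases hB : (π n).1.1 ∈ B
    · rw [if_pos hB] at this
      exact ⟨this hn'.1, fun h => absurd hB h⟩
    · rw [if_neg hB] at this
      obtain ⟨h₁, h₂⟩ := hlt _ _ (this (hn'.2.resolve_left hB))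
      rw [hΦ] at h₁
      exact ⟨hZ h₁.1, fun _ => h₂⟩
  have hmem : ∀ n, (π n).1 ∈ Z := fun n => by
    induction n with
    | zero => rwa [hπ]
    | succ n ih => exact (key n ih).1
  rintro ⟨k, hk⟩
  obtain ⟨n, hn⟩ := WellFounded.not_rel_apply_succ (r := (· < ·)) fun n => ρ (π (k + n)).1
  exact hn ((key _ (hmem _)).2 (hk _ (Nat.le_add_right k n)))

theorem InputEnabled.winning_coBuchi (hG : G.InputEnabled) (p : Player) (B : Set Loc) :
    G.sem.winning p (G.coBuchi B) = {s | s.1 ∈ G.coBuchiRegion p B ∅} := by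
  ext s
  refine ⟨fun h => ?_, hG.mem_winning_coBuchi p B⟩
  by_contra hs
  exact Set.disjoint_left.1 (G.sem.disjoint_winning p _) h (hG.mem_winning_compl_coBuchi p B hs)

end ProgramGame
end Winning

end ReactiveGame

theorem mainTheorem3 {L : FirstOrder.Language} {V : Type*} [L.Structure V] {I : Type*} [Finite I]
    {m : ℕ} {Loc : Type*} (G : ReactiveGame.ProgramGame L V I m Loc) (hG : G.InputEnabled)
    (p : ReactiveGame.Player) (B : Set Loc) (w : ReactiveGame.Dom L m Loc)
    (h : ReactiveGame.SolveBuchiAcc G B p (ReactiveGame.acceptingDom G B) w) :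
    w.sem G = G.sem.winning p.opp (G.coBuchi B) := by
  rw [hG.winning_coBuchi, ← h.sound hG]
  ext s
  exact ⟨fun hs => ⟨hs, s.2⟩, fun hs => hs.1⟩
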